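/- Let all alphabets be finite. A primitive is a joint probability distribution $P_{X,Y}$ on $\mathcal X\times\mathcal Y$; $H$, $I$ and $S$ denote the Shannon entropy, the classical mutual information and the von Neumann entropy, in bits, and $S(R;T)=S(R)+S(T)-S(RT)$ is the quantum mutual information. An embedding of $P_{X,Y}$ is a pure state $|\psi\rangle$ of registers $A,A'$ (held by Alice) and $B,B'$ (held by Bob), where $A$ has computational basis $\{|x\rangle\}_{x\in\mathcal X}$, $B$ has computational basis $\{|y\rangle\}_{y\in\mathcal Y}$ and $A',B'$ are working registers of arbitrary finite dimension, such that measuring $A$ and $B$ in the computational basis yields outcomes $(X,Y)$ distributed according to $P_{X,Y}$ and $$S(XA';Y)=S(X;YB')=I(X;Y),$$ where a register name replaced by $X$ or $Y$ means that the corresponding register $A$ or $B$ has been measured. Its leakage is $$\Delta_\psi(P_{X,Y})=\max\{S(X;BB')-I(X;Y),\ S(AA';Y)-I(X;Y)\},$$ where in $S(X;BB')$ only $A$ and in $S(AA';Y)$ only $B$ has been measured. The leakage $\Delta_{P_{X,Y}}$ of the primitive is the minimum (understood as an infimum) of $\Delta_\psi(P_{X,Y})$ over all embeddings $|\psi\rangle$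 of $P_{X,Y}$. Write $P\simeq Q$ if the joint distributions $P$ and $Q$ are equal up to relabeling of the alphabets, i.e. there are a bijection between the values that the first variable takes with positive probability under $P$ and under $Q$, and a bijection between the values that the second variable takes with positive probability, which together carry $P$ to $Q$. **Theorem.** Let $P_{X,Y}$ and $P_{X',Y'}=P_{X'_0X'_1,\,Y'_0Y'_1}$ be primitives and let $\delta\in\mathbb R$ be such that $$\sum_{(x,y)\,:\;P_{X'_0,Y'_0\mid X'_1=x,\,Y'_1=y}\,\simeq\,P_{X,Y}}P_{X'_1,Y'_1}(x,y)\ \ge\ 1-\delta .$$ Then the infima defining $\Delta_{P_{X,Y}}$ and $\Delta_{P_{X',Y'}}$ are finite and taken over non-empty sets, and $$\Delta_{P_{X',Y'}}\ \ge\ (1-\delta)\,\Delta_{P_{X,Y}} .$$ -/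

import Mathlib

namespace TwoParty

/-! ### Finite probability distributions -/

section Classical

variable {X Y : Type*} [Fintype X] [Fintype Y]

/-- Shannon entropy, in bits, of a distribution on a finite alphabet. -/
noncomputable def shannonEntropy (p : X → ℝ) : ℝ :=
  (∑ x, Real.negMulLog (p x)) / Real.log 2

/-- The marginal `P_X` of a joint distribution `P_{X,Y}`. -/
def marginalX (P : X × Y → ℝ) : X → ℝ := fun x => ∑ y, P (x, y)

/-- The marginal `P_Y` of a joint distribution `P_{X,Y}`. -/
def marginalY (P : X × Y → ℝ) : Y → ℝ := fun y => ∑ x, P (x, y)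

/-- Classical mutual information `I(X;Y) = H(X) + H(Y) - H(X,Y)`. -/
noncomputable def classicalInfo (P : X × Y → ℝ) : ℝ :=
  shannonEntropy (marginalX P) + shannonEntropy (marginalY P) - shannonEntropy P

/-- Two joint distributions are equal up to relabeling of the alphabets: there are a bijection
between the values that `X` takes with positive probability under the two distributions, and a
bijection between the values that `Y` takes with positive probability, which carry one distribution
to the other. Symbols that never occur are irrelevant, so the alphabets may have different sizes. -/
def EqualUpToRelabeling {X₂ Y₂ : Type*} [Fintype X₂] [Fintype Y₂]
    (P : X × Y → ℝ) (Q : X₂ × Y₂ → ℝ) : Prop :=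
  ∃ (f : {x : X // marginalX P x ≠ 0} ≃ {x : X₂ // marginalX Q x ≠ 0})
    (g : {y : Y // marginalY P y ≠ 0} ≃ {y : Y₂ // marginalY Q y ≠ 0}),
    ∀ x y, P (x.1, y.1) = Q ((f x).1, (g y).1)

variable {X₀ X₁ Y₀ Y₁ : Type*} [Fintype X₀] [Fintype X₁] [Fintype Y₀] [Fintype Y₁]

/-- The distribution `P_{X₁,Y₁}` of the second components of a distribution
`P_{X₀X₁,Y₀Y₁}`. -/
def secondMarginal (P : (X₀ × X₁) × (Y₀ × Y₁) → ℝ) (x₁ : X₁) (y₁ : Y₁) : ℝ :=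
  ∑ x₀, ∑ y₀, P ((x₀, x₁), (y₀, y₁))

/-- The conditional distribution `P_{X₀,Y₀|X₁=x₁,Y₁=y₁}`
(the zero function when `P_{X₁,Y₁}(x₁,y₁) = 0`). -/
noncomputable def conditional (P : (X₀ × X₁) × (Y₀ × Y₁) → ℝ) (x₁ : X₁) (y₁ : Y₁) :
    X₀ × Y₀ → ℝ :=
  fun z => P ((z.1, x₁), (z.2, y₁)) / secondMarginal P x₁ y₁

open scoped Classical in
/-- The probability, over `(X₁,Y₁)`, that `P_{X₀,Y₀|X₁=x₁,Y₁=y₁}` equals `Q` up to relabeling. -/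
noncomputable def relabelingProb (P : (X₀ × X₁) × (Y₀ × Y₁) → ℝ) (Q : X × Y → ℝ) : ℝ :=
  ∑ z : X₁ × Y₁ with EqualUpToRelabeling (conditional P z.1 z.2) Q, secondMarginal P z.1 z.2

end Classical

/-! ### Finite-dimensional quantum states, as matrices in the computational basis -/

section Quantum

variable {ι κ : Type*} [Fintype ι] [DecidableEq ι] [Fintype κ] [DecidableEq κ]

/-- Von Neumann entropy in bits: the Shannon entropy of the eigenvalues of the density matrix,
counted with multiplicity (these are real for a density matrix). -/
noncomputable def vonNeumannEntropy (ρ : Matrix ι ι ℂ) : ℝ :=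
  (ρ.charpoly.roots.map fun z => Real.negMulLog z.re).sum / Real.log 2

/-- Partial trace over the second subsystem. -/
def traceSecond (ρ : Matrix (ι × κ) (ι × κ) ℂ) : Matrix ι ι ℂ :=
  fun i j => ∑ k, ρ (i, k) (j, k)

/-- Partial trace over the first subsystem. -/
def traceFirst (ρ : Matrix (ι × κ) (ι × κ) ℂ) : Matrix κ κ ℂ :=
  fun k l => ∑ i, ρ (i, k) (i, l)

/-- Quantum mutual information of the two subsystems of a bipartite state `ρ`:
the entropies of both reduced states minus the entropy of `ρ`. -/
noncomputable def quantumInfo (ρ : Matrix (ι × κ) (ι × κ) ℂ) : ℝ :=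
  vonNeumannEntropy (traceSecond ρ) + vonNeumannEntropy (traceFirst ρ) - vonNeumannEntropy ρ

/-- The state after a measurement, in the computational basis, of the register whose content in
basis state `i` is `reg i`; the outcome is kept as a classical value in that register. -/
def measureReg {O : Type*} [DecidableEq O] (reg : ι → O) (ρ : Matrix ι ι ℂ) : Matrix ι ι ℂ :=
  fun i j => if reg i = reg j then ρ i j else 0

end Quantum

/-! ### Embeddings and leakage

A vector of `A ⊗ A' ⊗ B ⊗ B'` is given by its amplitudes `ψ ((x, a'), (y, b'))` in the computational
basis. Alice holds the output register `A` (basis `X`) and the working register `A'`, Bob holds the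
output register `B` (basis `Y`) and the working register `B'`. -/

section Leakage

variable {X Y A' B' : Type*} [Fintype X] [DecidableEq X] [Fintype Y] [DecidableEq Y]
  [Fintype A'] [DecidableEq A'] [Fintype B'] [DecidableEq B']

/-- The reduced state of `|ψ⟩⟨ψ|` on `A B B'`, with bipartition `A` versus `B B'`. -/
def stateABB (ψ : (X × A') × (Y × B') → ℂ) : Matrix (X × (Y × B')) (X × (Y × B')) ℂ :=
  fun i j => ∑ a, ψ ((i.1, a), i.2) * star (ψ ((j.1, a), j.2))

/-- The reduced state of `|ψ⟩⟨ψ|` on `A A' B`, with bipartition `A A'` versus `B`. -/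
def stateAAB (ψ : (X × A') × (Y × B') → ℂ) : Matrix ((X × A') × Y) ((X × A') × Y) ℂ :=
  fun i j => ∑ b, ψ (i.1, (i.2, b)) * star (ψ (j.1, (j.2, b)))

/-- `S(X ; B B')`: only `A` is measured. -/
noncomputable def infoX_BB (ψ : (X × A') × (Y × B') → ℂ) : ℝ :=
  quantumInfo (measureReg (fun i => i.1) (stateABB ψ))

/-- `S(A A' ; Y)`: only `B` is measured. -/
noncomputable def infoAA_Y (ψ : (X × A') × (Y × B') → ℂ) : ℝ :=
  quantumInfo (measureReg (fun i => i.2) (stateAAB ψ))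

/-- `S(X ; Y B')`: both `A` and `B` are measured. -/
noncomputable def infoX_YB (ψ : (X × A') × (Y × B') → ℂ) : ℝ :=
  quantumInfo (measureReg (fun i => (i.1, i.2.1)) (stateABB ψ))

/-- `S(X A' ; Y)`: both `A` and `B` are measured. -/
noncomputable def infoXA_Y (ψ : (X × A') × (Y × B') → ℂ) : ℝ :=
  quantumInfo (measureReg (fun i => (i.1.1, i.2)) (stateAAB ψ))

/-- `ψ` is an embedding of the primitive `P`: measuring the registers `A` and `B` in the
computational basis gives outcomes distributed according to `P` (so `ψ` is a unit vector when `P`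
is a probability distribution), and `S(X ; Y B') = S(X A' ; Y) = I(X;Y)`. -/
structure IsEmbedding (P : X × Y → ℝ) (ψ : (X × A') × (Y × B') → ℂ) : Prop where
  outcome : ∀ x y, ∑ a, ∑ b, ‖ψ ((x, a), (y, b))‖ ^ 2 = P (x, y)
  bob_work : infoX_YB ψ = classicalInfo P
  alice_work : infoXA_Y ψ = classicalInfo P

/-- The leakage of an embedding `ψ` of `P`. -/
noncomputable def leakageOf (P : X × Y → ℝ) (ψ : (X × A') × (Y × B') → ℂ) : ℝ :=
  max (infoX_BB ψ - classicalInfo P) (infoAA_Y ψ - classicalInfo P)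

/-- The set of leakages of all embeddings of `P`, over all finite dimensions `a`, `b` of the
working registers of the two players. -/
def leakageSet (P : X × Y → ℝ) : Set ℝ :=
  {Δ | ∃ (a b : ℕ) (ψ : (X × Fin a) × (Y × Fin b) → ℂ), IsEmbedding P ψ ∧ leakageOf P ψ = Δ}

/-- The leakage of the primitive `P`: the least leakage (infimum) over all its embeddings. -/
noncomputable def leakage (P : X × Y → ℝ) : ℝ := sInf (leakageSet P)

end Leakage

end TwoParty

/-! A state of the four registers is treated as a family of blocks `Ψ x y`, with α_xy = Ψ x y (Ψ x
y)ᴴ the unnormalised state of Alice's working register; entropies are in nats until the end. The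
condition S(XA';Y) = I(X;Y) is the equality case of the nonnegativity of a Holevo quantity, so it
says that for each x the states α_xy are pairwise proportional over y (`Regular`); the other
condition says the same for Bob (`isEmbedding_iff`). For such states the two quantities in the
maximum coincide (`leakageOf_eq`): both are, up to the factor log 2, S(Alice) - Σ S(α_xy) + 2 H(XY)
- H(X) - H(Y), which is homogeneous of degree one in the state (`leakNats`).

The heart is superadditivity of this expression over cells {f(X) = u, g(Y) = z}
(`sum_leakNats_cell_le`). When Bob measures Z = g(Y), Alice's reduced state splits as a sum of
matrices M_z. Monotonicity of relative entropy under measurement bounds Σ S(M_z) - S(Σ M_z) by the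
same expression for the diagonals in any orthonormal basis. In a basis that, for each x,
diagonalises Alice's state given x, regularity makes z and the basis label independent given x, and
the bound becomes H(XZ) - H(X). A second round, with U = f(X) and the players exchanged, costs H(YU)
- H(Y). The Shannon terms of the leakage change by exactly these amounts, so everything cancels.

For f = g = id the cells are single blocks, of leakage zero; hence leakage is nonnegative. For the
second components of the outcomes, a cell whose conditional distribution is P up to relabeling
becomes an embedding of P after rescaling, so it contributes at least its probability times the
leakage of P; the other cells contribute at least 0. -/

namespace TwoParty

open Matrix Polynomial

/-! ### Spectral entropy of unnormalised matrices -/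

section Spectral

variable {m n o : Type*} [Fintype m] [DecidableEq m] [Fintype n] [DecidableEq n]
  [Fintype o] [DecidableEq o]

/-- Von Neumann entropy in nats, with no normalisation assumed. -/
noncomputable def spectralEntropy (M : Matrix n n ℂ) : ℝ :=
  (M.charpoly.roots.map fun z => Real.negMulLog z.re).sum

theorem vonNeumannEntropy_eq (M : Matrix n n ℂ) :
    vonNeumannEntropy M = spectralEntropy M / Real.log 2 := rfl

theorem spectralEntropy_eq_of_charpoly {M : Matrix n n ℂ} {a : n → ℝ}
    (h : M.charpoly = ∏ i, (X - C (a i : ℂ))) :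
    spectralEntropy M = ∑ i, Real.negMulLog (a i) := by
  have hne : ∏ i : n, (X - C (a i : ℂ)) ≠ 0 :=
    Finset.prod_ne_zero_iff.mpr fun i _ => X_sub_C_ne_zero _
  rw [spectralEntropy, h, roots_prod _ _ hne]
  simp

theorem spectralEntropy_eq_eigenvalues {M : Matrix n n ℂ} (hM : M.IsHermitian) :
    spectralEntropy M = ∑ i, Real.negMulLog (hM.eigenvalues i) :=
  spectralEntropy_eq_of_charpoly hM.charpoly_eq

theorem spectralEntropy_diagonal (a : n → ℝ) :
    spectralEntropy (diagonal fun i => (a i : ℂ)) = ∑ i, Real.negMulLog (a i) :=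
  spectralEntropy_eq_of_charpoly (charpoly_diagonal _)

theorem spectralEntropy_transpose (M : Matrix n n ℂ) :
    spectralEntropy Mᵀ = spectralEntropy M := by
  rw [spectralEntropy, charpoly_transpose, spectralEntropy]

theorem spectralEntropy_reindex (e : m ≃ n) (M : Matrix m m ℂ) :
    spectralEntropy (reindex e e M) = spectralEntropy M := by
  rw [spectralEntropy, charpoly_reindex, spectralEntropy]

/-- The two characteristic polynomials agree up to powers of `X`, and zero roots contribute
`negMulLog 0 = 0`. This identifies the entropies of the two halves of a pure state. -/
theorem spectralEntropy_mul_comm (A : Matrix m n ℂ) (B : Matrix n m ℂ) :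
    spectralEntropy (A * B) = spectralEntropy (B * A) := by
  have key : ∀ (k : ℕ) (p : ℂ[X]), p ≠ 0 →
      (((X : ℂ[X]) ^ k * p).roots.map fun z : ℂ => Real.negMulLog z.re).sum =
        (p.roots.map fun z => Real.negMulLog z.re).sum := by
    intro k p hp
    rw [roots_mul (mul_ne_zero (pow_ne_zero _ X_ne_zero) hp)]
    simp [Multiset.map_nsmul, Multiset.sum_nsmul]
  rw [spectralEntropy, ← key (Fintype.card n) _ (charpoly_monic _).ne_zero, charpoly_mul_comm',
    key _ _ (charpoly_monic _).ne_zero, spectralEntropy]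

theorem spectralEntropy_blockDiagonal (M : o → Matrix n n ℂ) :
    spectralEntropy (blockDiagonal M) = ∑ k, spectralEntropy (M k) := by
  have h : (blockDiagonal M).charpoly = ∏ k, (M k).charpoly := by
    have : charmatrix (blockDiagonal M) = blockDiagonal fun k => charmatrix (M k) := by
      ext ⟨i, k⟩ ⟨j, l⟩ : 2
      by_cases hkl : k = l
      · subst hkl
        by_cases hij : i = j
        · subst hij; simp [blockDiagonal_apply]
        · simp [blockDiagonal_apply, hij]
      · simp [blockDiagonal_apply, hkl]
    rw [charpoly, this, det_blockDiagonal]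
    rfl
  have hne : ∏ k, (M k).charpoly ≠ 0 :=
    Finset.prod_ne_zero_iff.mpr fun i _ => (charpoly_monic _).ne_zero
  rw [spectralEntropy, h, roots_prod _ _ hne, Multiset.map_bind, Multiset.sum_bind]
  rfl

/-- A matrix on `o × n` that is block diagonal in the first factor. -/
theorem spectralEntropy_block (M : o → Matrix n n ℂ) :
    spectralEntropy (Matrix.of fun i j : o × n => if i.1 = j.1 then M i.1 i.2 j.2 else 0) =
      ∑ k, spectralEntropy (M k) := by
  rw [← spectralEntropy_blockDiagonal, ← spectralEntropy_reindex (Equiv.prodComm o n)]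
  congr 1

theorem spectralEntropy_unitary_conj {U : Matrix n n ℂ} (hU : Uᴴ * U = 1) (M : Matrix n n ℂ) :
    spectralEntropy (Uᴴ * M * U) = spectralEntropy M := by
  rw [spectralEntropy_mul_comm, ← mul_assoc, mul_eq_one_comm.mp hU, one_mul]

theorem exists_diagonalization {M : Matrix n n ℂ} (hM : M.IsHermitian) :
    ∃ (U : Matrix n n ℂ), Uᴴ * U = 1 ∧ U * Uᴴ = 1 ∧
      M = U * diagonal (fun i => (hM.eigenvalues i : ℂ)) * Uᴴ := by
  refine ⟨hM.eigenvectorUnitary, ?_, ?_, ?_⟩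
  · exact Unitary.coe_star_mul_self hM.eigenvectorUnitary
  · exact Unitary.coe_mul_star_self hM.eigenvectorUnitary
  · have := hM.spectral_theorem
    rw [Unitary.conjStarAlgAut_apply] at this
    exact this

theorem spectralEntropy_diagonalized {U : Matrix n n ℂ} (hU : Uᴴ * U = 1) (a : n → ℝ) :
    spectralEntropy (U * diagonal (fun i => (a i : ℂ)) * Uᴴ) = ∑ i, Real.negMulLog (a i) := by
  rw [spectralEntropy_mul_comm, ← mul_assoc, hU, one_mul, spectralEntropy_diagonal]

theorem spectralEntropy_smul {M : Matrix n n ℂ} (hM : M.IsHermitian) (c : ℝ) :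
    spectralEntropy ((c : ℂ) • M) =
      c * spectralEntropy M + Real.negMulLog c * M.trace.re := by
  obtain ⟨U, hU, -, h⟩ := exists_diagonalization hM
  have h2 : (c : ℂ) • M = U * diagonal (fun i => ((c * hM.eigenvalues i : ℝ) : ℂ)) * Uᴴ := by
    conv_lhs => rw [h]
    rw [← smul_mul_assoc, ← mul_smul_comm]
    congr 2
    ext i j
    by_cases hij : i = j <;> simp [hij]
  rw [h2, spectralEntropy_diagonalized hU, spectralEntropy_eq_eigenvalues hM,
    hM.trace_eq_sum_eigenvalues]
  simp only [Real.negMulLog_mul, Finset.sum_add_distrib, ← Finset.mul_sum, ← Finset.sum_mul]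
  simp
  ring

theorem spectralEntropy_zero : spectralEntropy (0 : Matrix n n ℂ) = 0 := by
  simpa using spectralEntropy_diagonal (n := n) fun _ => (0 : ℝ)

end Spectral

end TwoParty

namespace TwoParty

open Matrix Filter Topology
open scoped ComplexOrder

/-! ### Comparing logarithmic sums through their resolvents -/

section LogComparison

variable {ι κ : Type*} [Fintype ι] [Fintype κ]

theorem hasDerivAt_const_mul_log_add {c r s : ℝ} (hs : 0 ≤ s) (hr : c ≠ 0 → 0 < r) :
    HasDerivAt (fun s => c * Real.log (s + r)) (c / (s + r)) s := by
  by_cases hc : c = 0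
  · simpa [hc] using hasDerivAt_const s (0 : ℝ)
  · have h : s + r ≠ 0 := (add_pos_of_nonneg_of_pos hs (hr hc)).ne'
    simpa [div_eq_mul_inv] using (((hasDerivAt_id s).add_const r).log h).const_mul c

theorem tendsto_log_add_sub_log (r : ℝ) :
    Tendsto (fun s : ℝ => Real.log (s + r) - Real.log s) atTop (𝓝 0) := by
  have h1 : Tendsto (fun s : ℝ => Real.log (1 + r / s)) atTop (𝓝 0) := by
    have : Tendsto (fun s : ℝ => 1 + r / s) atTop (𝓝 1) := by
      simpa using (tendsto_const_nhds (x := (1 : ℝ))).add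
        ((tendsto_const_nhds (x := r)).div_atTop tendsto_id)
    simpa using this.log one_ne_zero
  refine h1.congr' ?_
  filter_upwards [eventually_gt_atTop 0, eventually_gt_atTop (-r)] with s hs hr
  rw [← Real.log_div (by linarith) hs.ne']
  congr 1
  field_simp

/-- Comparison of logarithmic sums from the comparison of their resolvents. -/
theorem sum_mul_log_le {c r : ι → ℝ} {d q : κ → ℝ} (hr : ∀ i, c i ≠ 0 → 0 < r i)
    (hq : ∀ k, d k ≠ 0 → 0 < q k) (hcd : ∑ i, c i = ∑ k, d k)
    (h : ∀ s > 0, ∑ k, d k / (s + q k) ≤ ∑ i, c i / (s + r i)) :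
    ∑ i, c i * Real.log (r i) ≤ ∑ k, d k * Real.log (q k) := by
  -- `K` has nonnegative derivative by the resolvent comparison and tends to 0 at infinity, because
  -- equal total weights cancel the `log s` terms. Hence `K 0 ≤ 0`.
  set K : ℝ → ℝ := fun s => ∑ i, c i * Real.log (s + r i) - ∑ k, d k * Real.log (s + q k) with hK
  have hder : ∀ s, 0 ≤ s →
      HasDerivAt K (∑ i, c i / (s + r i) - ∑ k, d k / (s + q k)) s := fun s hs =>
    (HasDerivAt.fun_sum fun i _ => hasDerivAt_const_mul_log_add hs (hr i)).sub
      (HasDerivAt.fun_sum fun k _ => hasDerivAt_const_mul_log_add hs (hq k))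
  have hmono : MonotoneOn K (Set.Ici 0) := by
    refine monotoneOn_of_deriv_nonneg (convex_Ici 0)
      (fun s hs => (hder s hs).continuousAt.continuousWithinAt) ?_ ?_
    · intro s hs
      rw [interior_Ici] at hs
      exact (hder s (le_of_lt hs)).differentiableAt.differentiableWithinAt
    · intro s hs
      rw [interior_Ici] at hs
      rw [(hder s (le_of_lt hs)).deriv]
      linarith [h s hs]
  have hlim : Tendsto K atTop (𝓝 0) := by
    have h1 : Tendsto (fun s : ℝ => ∑ i, c i * (Real.log (s + r i) - Real.log s) -
        ∑ k, d k * (Real.log (s + q k) - Real.log s)) atTop (𝓝 0) := by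
      have := (tendsto_finsetSum Finset.univ fun i _ =>
        (tendsto_log_add_sub_log (r i)).const_mul (c i)).sub
        (tendsto_finsetSum Finset.univ fun k _ =>
        (tendsto_log_add_sub_log (q k)).const_mul (d k))
      simpa using this
    refine h1.congr fun s => ?_
    simp only [hK, mul_sub, Finset.sum_sub_distrib, ← Finset.sum_mul, hcd]
    ring
  have h0 : K 0 ≤ 0 := by
    refine ge_of_tendsto hlim ?_
    filter_upwards [eventually_ge_atTop 0] with s hs
    exact hmono (Set.mem_Ici.mpr le_rfl) hs hs
  simpa [hK] using h0

end LogComparison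

/-! ### Monotonicity of relative entropy under measurement -/

section RelativeEntropy

variable {n ι : Type*} [Fintype n] [DecidableEq n] [Fintype ι]

/-- The spectral decomposition `A = U diag(a) Uᴴ`. -/
structure Diagonalizes (A U : Matrix n n ℂ) (a : n → ℝ) : Prop where
  left_inv : Uᴴ * U = 1
  right_inv : U * Uᴴ = 1
  eq : A = U * diagonal (fun i => (a i : ℂ)) * Uᴴ

variable {A B U V : Matrix n n ℂ} {a b : n → ℝ}

theorem exists_diagonalizes (hA : A.PosSemidef) :
    ∃ U a, Diagonalizes A U a ∧ ∀ i, 0 ≤ a i := by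
  obtain ⟨U, h1, h2, h3⟩ := exists_diagonalization hA.isHermitian
  exact ⟨U, _, ⟨h1, h2, h3⟩, hA.eigenvalues_nonneg⟩

omit [Fintype n] [DecidableEq n] in
theorem re_diag_nonneg (hA : A.PosSemidef) (k : n) : 0 ≤ (A k k).re :=
  (Complex.nonneg_iff.mp hA.diag_nonneg).1

theorem Diagonalizes.spectralEntropy_eq (hA : Diagonalizes A U a) :
    spectralEntropy A = ∑ i, Real.negMulLog (a i) := by
  rw [hA.eq, spectralEntropy_diagonalized hA.left_inv]

theorem Diagonalizes.conj_eq (hA : Diagonalizes A U a) :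
    Uᴴ * A * U = diagonal (fun i => (a i : ℂ)) := by
  have : Uᴴ * A * U = (Uᴴ * U) * diagonal (fun i => (a i : ℂ)) * (Uᴴ * U) := by
    rw [hA.eq]; simp only [mul_assoc]
  rw [this, hA.left_inv, one_mul, mul_one]

theorem Diagonalizes.trace_eq (hA : Diagonalizes A U a) : A.trace.re = ∑ i, a i := by
  rw [hA.eq, trace_mul_comm, ← mul_assoc, hA.left_inv, one_mul]
  simp [trace]

/-- Squared overlaps of the columns of `U` and `V`. -/
noncomputable def overlap (U V : Matrix n n ℂ) (i j : n) : ℝ := Complex.normSq ((Uᴴ * V) i j)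

omit [DecidableEq n] in
theorem overlap_nonneg (i j : n) : 0 ≤ overlap U V i j := Complex.normSq_nonneg _

theorem sum_overlap_left (hU : U * Uᴴ = 1) (hV : Vᴴ * V = 1) (j : n) :
    ∑ i, overlap U V i j = 1 := by
  have h : (Uᴴ * V)ᴴ * (Uᴴ * V) = 1 := by
    rw [conjTranspose_mul, conjTranspose_conjTranspose, mul_assoc, ← mul_assoc U, hU, one_mul, hV]
  have h2 := congrArg Complex.re (congrFun (congrFun h j) j)
  rw [mul_apply, Complex.re_sum] at h2
  simp only [overlap]
  rw [one_apply_eq, Complex.one_re] at h2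
  rw [← h2]
  refine Finset.sum_congr rfl fun i _ => ?_
  simp [Complex.normSq_apply]

theorem sum_overlap_right (hU : Uᴴ * U = 1) (hV : V * Vᴴ = 1) (i : n) :
    ∑ j, overlap U V i j = 1 := by
  have h : (Uᴴ * V) * (Uᴴ * V)ᴴ = 1 := by
    rw [conjTranspose_mul, conjTranspose_conjTranspose, mul_assoc, ← mul_assoc V, hV, one_mul, hU]
  have h2 := congrArg Complex.re (congrFun (congrFun h i) i)
  rw [mul_apply, Complex.re_sum] at h2
  simp only [overlap]
  rw [one_apply_eq, Complex.one_re] at h2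
  rw [← h2]
  refine Finset.sum_congr rfl fun i _ => ?_
  simp [Complex.normSq_apply]

theorem re_diag_conj_eq_sum (hA : Diagonalizes A U a) (j : n) :
    ((Vᴴ * A * V) j j).re = ∑ i, overlap U V i j * a i := by
  have h : Vᴴ * A * V = (Uᴴ * V)ᴴ * (diagonal (fun i => (a i : ℂ)) * (Uᴴ * V)) := by
    rw [hA.eq, conjTranspose_mul, conjTranspose_conjTranspose]; simp only [mul_assoc]
  rw [h, mul_apply, Complex.re_sum]
  refine Finset.sum_congr rfl fun i _ => ?_
  rw [diagonal_mul, conjTranspose_apply]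
  simp [overlap, Complex.normSq_apply]
  ring

/-- One term of the variational formula for `a² / (s a + b)`. -/
theorem two_mul_re_sub_le {s a b : ℝ} (hs : 0 < s) (ha : 0 ≤ a) (hb : 0 ≤ b) (w x : ℂ) :
    2 * a * (x * star w).re - (s * a + b) * Complex.normSq x ≤
      Complex.normSq w * a ^ 2 / (s * a + b) := by
  rcases ha.eq_or_lt with rfl | ha
  · simpa using mul_nonneg hb (Complex.normSq_nonneg x)
  · have hpos : 0 < s * a + b := by positivity
    rw [le_div_iff₀ hpos]
    simp only [Complex.normSq_apply, Complex.mul_re, Complex.star_def, Complex.conj_re,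
      Complex.conj_im]
    -- After clearing the denominator, the difference of the two sides is |(s a + b) x - a w|².
    nlinarith [sq_nonneg ((s * a + b) * x.re - a * w.re),
      sq_nonneg ((s * a + b) * x.im - a * w.im)]

/-- The right side bounds a concave quadratic functional of an arbitrary trial matrix, term by term
in the eigenbases of `A` and `B`. The left side is that functional at the diagonal trial matrix `D`;
this restriction is where the measurement enters. -/
theorem sum_variational_le (hA : Diagonalizes A U a) (hB : Diagonalizes B V b)
    (ha : ∀ i, 0 ≤ a i) (hb : ∀ i, 0 ≤ b i) {s : ℝ} (hs : 0 < s) (c : n → ℝ) :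
    ∑ k, (2 * (A k k).re * c k - (s * (A k k).re + (B k k).re) * c k ^ 2) ≤
      ∑ i, ∑ j, overlap U V i j * a i ^ 2 / (s * a i + b j) := by
  set D : Matrix n n ℂ := diagonal fun i => (c i : ℂ) with hD
  have hDs : Dᴴ = D := by
    rw [hD, diagonal_conjTranspose]; congr 1; ext i; simp
  set W := Uᴴ * V with hW
  set Z := Uᴴ * D * V with hZ
  have tr1 : (diagonal (fun i => (a i : ℂ)) * (Z * Wᴴ)).trace = (A * D).trace := by
    have : diagonal (fun i => (a i : ℂ)) * (Z * Wᴴ) =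
        diagonal (fun i => (a i : ℂ)) * Uᴴ * D * (V * Vᴴ) * U := by
      simp only [hZ, hW, conjTranspose_mul, conjTranspose_conjTranspose, mul_assoc]
    rw [this, hB.right_inv, mul_one, trace_mul_comm, hA.eq]
    simp only [mul_assoc]
  have tr2 : (diagonal (fun i => (a i : ℂ)) * (Z * Zᴴ)).trace = (A * (D * D)).trace := by
    have : diagonal (fun i => (a i : ℂ)) * (Z * Zᴴ) =
        diagonal (fun i => (a i : ℂ)) * Uᴴ * D * (V * Vᴴ) * D * U := by
      simp only [hZ, conjTranspose_mul, conjTranspose_conjTranspose, mul_assoc, hDs]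
    rw [this, hB.right_inv, mul_one, trace_mul_comm, hA.eq]
    simp only [mul_assoc]
  have tr3 : (Z * diagonal (fun i => (b i : ℂ)) * Zᴴ).trace = (B * (D * D)).trace := by
    have : Z * diagonal (fun i => (b i : ℂ)) * Zᴴ = Uᴴ * (D * B * D * U) := by
      simp only [hZ, conjTranspose_mul, conjTranspose_conjTranspose, mul_assoc, hDs, hB.eq]
    rw [this, trace_mul_comm, mul_assoc, hA.right_inv, mul_one, mul_assoc, trace_mul_comm,
      mul_assoc]
  have e1 : ∑ k, (A k k).re * c k = ∑ i, ∑ j, a i * (Z i j * star (W i j)).re := by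
    have := congrArg Complex.re tr1
    simp only [trace, diag_apply, diagonal_mul, Complex.re_sum, hD, mul_diagonal, Matrix.mul_apply (M := Z),
      conjTranspose_apply, Complex.re_ofReal_mul, Complex.re_mul_ofReal, Finset.mul_sum] at this
    exact this.symm
  have e2 : ∑ k, (A k k).re * c k ^ 2 = ∑ i, ∑ j, a i * Complex.normSq (Z i j) := by
    have := congrArg Complex.re tr2
    simp only [trace, diag_apply, diagonal_mul, Complex.re_sum, hD, diagonal_mul_diagonal,
      mul_diagonal, Matrix.mul_apply (M := Z), ← Complex.ofReal_mul,
      conjTranspose_apply, Complex.re_ofReal_mul, Complex.re_mul_ofReal, Finset.mul_sum] at this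
    simp only [sq]
    rw [← this]
    simp [Complex.normSq_apply]
  have e3 : ∑ k, (B k k).re * c k ^ 2 = ∑ i, ∑ j, b j * Complex.normSq (Z i j) := by
    have := congrArg Complex.re tr3
    simp only [trace, diag_apply, Complex.re_sum, hD, diagonal_mul_diagonal,
      mul_diagonal, Matrix.mul_apply (N := Zᴴ), ← Complex.ofReal_mul,
      conjTranspose_apply, Complex.re_mul_ofReal] at this
    simp only [sq]
    rw [← this]
    refine Finset.sum_congr rfl fun i _ => Finset.sum_congr rfl fun j _ => ?_
    simp [Complex.normSq_apply]
    ring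
  have : ∑ k, (2 * (A k k).re * c k - (s * (A k k).re + (B k k).re) * c k ^ 2) =
      ∑ i, ∑ j, (2 * a i * (Z i j * star (W i j)).re -
        (s * a i + b j) * Complex.normSq (Z i j)) := by
    have l : ∑ k, (2 * (A k k).re * c k - (s * (A k k).re + (B k k).re) * c k ^ 2) =
        2 * ∑ k, (A k k).re * c k - s * ∑ k, (A k k).re * c k ^ 2 - ∑ k, (B k k).re * c k ^ 2 := by
      simp only [Finset.mul_sum, ← Finset.sum_sub_distrib]
      exact Finset.sum_congr rfl fun k _ => by ring
    rw [l, e1, e2, e3]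
    simp only [Finset.mul_sum, ← Finset.sum_sub_distrib]
    exact Finset.sum_congr rfl fun i _ => Finset.sum_congr rfl fun j _ => by ring
  rw [this]
  exact Finset.sum_le_sum fun i _ => Finset.sum_le_sum fun j _ =>
    two_mul_re_sub_le hs (ha i) (hb j) _ _

/-- Compare the diagonals of `A` and `B` in the eigenbasis of `B`. Consequently `b j > 0` wherever
the weight `overlap U V i j * a i` is nonzero, so default values of logarithm and division never
matter. -/
theorem overlap_mul_le (hA : Diagonalizes A U a) (hB : Diagonalizes B V b)
    (ha : ∀ i, 0 ≤ a i) (hAB : (B - A).PosSemidef) (i j : n) : overlap U V i j * a i ≤ b j := by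
  have h := re_diag_nonneg (hAB.conjTranspose_mul_mul_same V) j
  rw [mul_sub, sub_mul, hB.conj_eq, Matrix.sub_apply, Complex.sub_re, re_diag_conj_eq_sum hA] at h
  have h1 : overlap U V i j * a i ≤ ∑ i, overlap U V i j * a i :=
    Finset.single_le_sum (f := fun i => overlap U V i j * a i)
      (fun i _ => mul_nonneg (overlap_nonneg i j) (ha i)) (Finset.mem_univ i)
  simp at h
  linarith

/-- The relative entropy of `A ≤ B` in terms of the two spectra. -/
theorem sum_overlap_mul_log (hA : Diagonalizes A U a) (hB : Diagonalizes B V b)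
    (ha : ∀ i, 0 ≤ a i) (hAB : (B - A).PosSemidef) :
    ∑ i, ∑ j, overlap U V i j * a i * Real.log (b j / a i) =
      spectralEntropy A + ∑ j, ((Vᴴ * A * V) j j).re * Real.log (b j) := by
  have h : ∀ i j, overlap U V i j * a i * Real.log (b j / a i) =
      overlap U V i j * Real.negMulLog (a i) + overlap U V i j * a i * Real.log (b j) := by
    intro i j
    by_cases h0 : overlap U V i j * a i = 0
    · rw [h0]
      rcases mul_eq_zero.mp h0 with h | h <;> simp [h]
    · have hpos : 0 < overlap U V i j * a i :=
        lt_of_le_of_ne (mul_nonneg (overlap_nonneg i j) (ha i)) (Ne.symm h0)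
      have hbj := hpos.trans_le (overlap_mul_le hA hB ha hAB i j)
      rw [Real.log_div hbj.ne' (right_ne_zero_of_mul h0), Real.negMulLog]
      ring
  simp only [h, Finset.sum_add_distrib, ← Finset.sum_mul, sum_overlap_right hA.left_inv hB.right_inv,
    one_mul, hA.spectralEntropy_eq, re_diag_conj_eq_sum hA]
  congr 1
  rw [Finset.sum_comm]
  simp only [Finset.sum_mul]

/-- Relative entropy does not increase under measurement in the computational basis. -/
theorem measured_relative_entropy_le (hA : Diagonalizes A U a) (hB : Diagonalizes B V b)
    (ha : ∀ i, 0 ≤ a i) (hb : ∀ i, 0 ≤ b i) (hAp : A.PosSemidef) (hAB : (B - A).PosSemidef) :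
    spectralEntropy A + ∑ j, ((Vᴴ * A * V) j j).re * Real.log (b j) ≤
      ∑ k, Real.negMulLog (A k k).re + ∑ k, (A k k).re * Real.log (B k k).re := by
  have hα := re_diag_nonneg hAp
  have hβ : ∀ k, (A k k).re ≤ (B k k).re := fun k => by
    simpa using re_diag_nonneg hAB k
  -- With these choices `c / (s + r)` is `overlap * a² / (s a + b)`, the summand of the variational
  -- bound.
  have key := sum_mul_log_le (ι := n × n) (κ := n)
    (c := fun p => overlap U V p.1 p.2 * a p.1) (r := fun p => b p.2 / a p.1)
    (d := fun k => (A k k).re) (q := fun k => (B k k).re / (A k k).re) ?_ ?_ ?_ ?_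
  · rw [Fintype.sum_prod_type] at key
    simp only at key
    rw [sum_overlap_mul_log hA hB ha hAB] at key
    refine key.trans_eq ?_
    rw [← Finset.sum_add_distrib]
    refine Finset.sum_congr rfl fun k _ => ?_
    by_cases h0 : (A k k).re = 0
    · simp [h0]
    · have : 0 < (A k k).re := lt_of_le_of_ne (hα k) (Ne.symm h0)
      rw [Real.log_div (this.trans_le (hβ k)).ne' h0, Real.negMulLog]
      ring
  · rintro ⟨i, j⟩ h0
    simp only at h0 ⊢
    have hpos : 0 < overlap U V i j * a i :=
      lt_of_le_of_ne (mul_nonneg (overlap_nonneg i j) (ha i)) (Ne.symm h0)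
    exact div_pos (hpos.trans_le (overlap_mul_le hA hB ha hAB i j))
      (lt_of_le_of_ne (ha i) (Ne.symm (right_ne_zero_of_mul h0)))
  · intro k h0
    have : 0 < (A k k).re := lt_of_le_of_ne (hα k) (Ne.symm h0)
    exact div_pos (this.trans_le (hβ k)) this
  · rw [Fintype.sum_prod_type]
    simp only [← Finset.sum_mul, sum_overlap_right hA.left_inv hB.right_inv, one_mul]
    rw [← hA.trace_eq, trace, Complex.re_sum]
    rfl
  · intro s hs
    -- The trial entries maximise each summand on the left, with value `(A k k)² / (s A k k + B k
    -- k)`.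
    have hv := sum_variational_le hA hB ha hb hs
      (fun k => (A k k).re / (s * (A k k).re + (B k k).re))
    rw [Fintype.sum_prod_type]
    convert hv using 1
    · refine Finset.sum_congr rfl fun k _ => ?_
      rcases (hα k).eq_or_lt with h0 | h0
      · simp [← h0]
      · have h1 := h0.trans_le (hβ k)
        have h2 : s * (A k k).re + (B k k).re ≠ 0 := by positivity
        field_simp
        ring
    · refine Finset.sum_congr rfl fun i _ => Finset.sum_congr rfl fun j _ => ?_
      rcases (ha i).eq_or_lt with h0 | h0
      · simp [← h0]
      · have h2 : s * a i + b j ≠ 0 := by have := hb j; positivity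
        simp only
        field_simp

end RelativeEntropy

end TwoParty

namespace TwoParty

open Matrix Filter Topology
open scoped ComplexOrder

/-! ### Splitting a state into a sum: Klein and Holevo inequalities with equality cases -/

section Families

variable {n ι : Type*} [Fintype n] [DecidableEq n] [Fintype ι]

omit [Fintype n] [DecidableEq n] in
theorem posSemidef_sum_univ {M : ι → Matrix n n ℂ} (hM : ∀ k, (M k).PosSemidef) :
    (∑ k, M k).PosSemidef :=
  posSemidef_sum Finset.univ fun k _ => hM k

omit [Fintype n] [DecidableEq n] in
theorem posSemidef_sum_sub {M : ι → Matrix n n ℂ} (hM : ∀ k, (M k).PosSemidef) (k : ι) :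
    (∑ l, M l - M k).PosSemidef := by
  classical
  rw [← Finset.sum_erase_eq_sub (Finset.mem_univ k)]
  exact posSemidef_sum _ fun l _ => hM l

/-- With N = Σ M_k this is Σ Tr(M_k log N) = Tr(N log N), written in the eigenbasis of N. -/
theorem sum_conj_diag_mul_log {M : ι → Matrix n n ℂ} {V : Matrix n n ℂ} {b : n → ℝ}
    (hB : Diagonalizes (∑ k, M k) V b) :
    ∑ k, ∑ j, ((Vᴴ * M k * V) j j).re * Real.log (b j) = -spectralEntropy (∑ k, M k) := by
  rw [hB.spectralEntropy_eq, Finset.sum_comm, ← Finset.sum_neg_distrib]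
  refine Finset.sum_congr rfl fun j _ => ?_
  rw [← Finset.sum_mul, ← Complex.re_sum, ← Matrix.sum_apply, ← Finset.sum_mul, ← Finset.mul_sum,
    hB.conj_eq]
  simp [Real.negMulLog]

/-- Superadditivity of the entropy deficit under measurement in the computational basis. -/
theorem sum_spectralEntropy_le_diag {M : ι → Matrix n n ℂ} (hM : ∀ k, (M k).PosSemidef) :
    ∑ k, spectralEntropy (M k) ≤ spectralEntropy (∑ k, M k) +
      ∑ k, ∑ i, Real.negMulLog (M k i i).re - ∑ i, Real.negMulLog (∑ k, (M k i i).re) := by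
  obtain ⟨V, b, hB, hb⟩ := exists_diagonalizes (posSemidef_sum_univ hM)
  have h : ∀ k, spectralEntropy (M k) + ∑ j, ((Vᴴ * M k * V) j j).re * Real.log (b j) ≤
      ∑ i, Real.negMulLog (M k i i).re + ∑ i, (M k i i).re * Real.log (∑ l, (M l i i).re) := by
    intro k
    obtain ⟨U, a, hA, ha⟩ := exists_diagonalizes (hM k)
    have := measured_relative_entropy_le hA hB ha hb (hM k) (posSemidef_sum_sub hM k)
    simpa only [Matrix.sum_apply, Complex.re_sum] using this
  have hs := Finset.sum_le_sum fun k (_ : k ∈ Finset.univ) => h k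
  rw [Finset.sum_add_distrib, Finset.sum_add_distrib, sum_conj_diag_mul_log hB,
    Finset.sum_comm (f := fun k i => (M k i i).re * Real.log (∑ l, (M l i i).re))] at hs
  simp only [← Finset.sum_mul] at hs
  have : ∑ i, Real.negMulLog (∑ k, (M k i i).re) =
      -∑ i, (∑ k, (M k i i).re) * Real.log (∑ k, (M k i i).re) := by
    simp [Real.negMulLog]
  linarith

/-- Superadditivity of the entropy deficit under measurement in an orthonormal basis. -/
theorem sum_spectralEntropy_le_conj_diag {M : ι → Matrix n n ℂ} (hM : ∀ k, (M k).PosSemidef)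
    {V : Matrix n n ℂ} (hV : Vᴴ * V = 1) :
    ∑ k, spectralEntropy (M k) ≤ spectralEntropy (∑ k, M k) +
      ∑ k, ∑ i, Real.negMulLog ((Vᴴ * M k * V) i i).re -
      ∑ i, Real.negMulLog (∑ k, ((Vᴴ * M k * V) i i).re) := by
  have := sum_spectralEntropy_le_diag fun k => (hM k).conjTranspose_mul_mul_same V
  rw [← Finset.sum_mul, ← Finset.mul_sum] at this
  simpa only [spectralEntropy_unitary_conj hV] using this

variable {A B : Matrix n n ℂ}

omit [DecidableEq n] in
theorem trace_re_nonneg (hA : A.PosSemidef) : 0 ≤ A.trace.re :=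
  (Complex.nonneg_iff.mp hA.trace_nonneg).1

omit [DecidableEq n] in
theorem trace_eq_re (hA : A.PosSemidef) : A.trace = (A.trace.re : ℂ) :=
  Complex.eq_re_of_ofReal_le (r := 0) (by simpa using hA.trace_nonneg)

omit [DecidableEq n] in
theorem eq_zero_of_trace_re (hA : A.PosSemidef) (h : A.trace.re = 0) : A = 0 := by
  classical
  refine hA.trace_eq_zero_iff.mp ?_
  rw [trace_eq_re hA, h, Complex.ofReal_zero]

/-- Apply log x ≤ x - 1 at x = t b_j / a_i with weight `overlap * a i`; the linear terms cancel
because the traces of `A` and `t B` agree. Equality forces a_i = t b_j wherever the overlap is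
nonzero. -/
theorem klein_of_trace_pos {U V : Matrix n n ℂ} {a b : n → ℝ}
    (hA : Diagonalizes A U a) (hB : Diagonalizes B V b) (ha : ∀ i, 0 ≤ a i) (hb : ∀ i, 0 ≤ b i)
    (hAB : (B - A).PosSemidef) {t : ℝ} (ht : 0 < t) (htr : A.trace.re = t * B.trace.re) :
    spectralEntropy A + ∑ j, ((Vᴴ * A * V) j j).re * Real.log (b j) ≤
        -(A.trace.re * Real.log t) ∧
      (spectralEntropy A + ∑ j, ((Vᴴ * A * V) j j).re * Real.log (b j) =
        -(A.trace.re * Real.log t) → A = (t : ℂ) • B) := by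
  have hterm : ∀ i j, 0 ≤ overlap U V i j * (t * b j - a i) -
        (overlap U V i j * a i * Real.log (b j / a i) + overlap U V i j * a i * Real.log t) ∧
      (overlap U V i j * (t * b j - a i) - (overlap U V i j * a i * Real.log (b j / a i) +
        overlap U V i j * a i * Real.log t) = 0 → overlap U V i j = 0 ∨ a i = t * b j) := by
    intro i j
    have hw := overlap_nonneg (U := U) (V := V) i j
    by_cases h0 : overlap U V i j * a i = 0
    · have : overlap U V i j * (t * b j - a i) = overlap U V i j * t * b j := by
        linear_combination -h0
      rw [h0, this]
      have hbj := hb j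
      refine ⟨by simp only [zero_mul, add_zero, sub_zero]; positivity, fun h => ?_⟩
      rcases mul_eq_zero.mp h0 with h1 | h1
      · exact Or.inl h1
      · simp only [zero_mul, add_zero, sub_zero, mul_eq_zero, ht.ne', or_false] at h
        rcases h with h | h
        · exact Or.inl h
        · right; simp [h1, h]
    · have hpos : 0 < overlap U V i j * a i :=
        lt_of_le_of_ne (mul_nonneg hw (ha i)) (Ne.symm h0)
      have hbj := hpos.trans_le (overlap_mul_le hA hB ha hAB i j)
      have hai := lt_of_le_of_ne (ha i) (Ne.symm (right_ne_zero_of_mul h0))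
      have hx : 0 < t * b j / a i := by positivity
      have hlog : Real.log (t * b j / a i) = Real.log (b j / a i) + Real.log t := by
        rw [mul_div_assoc, Real.log_mul ht.ne' (by positivity)]; ring
      have heq : overlap U V i j * (t * b j - a i) - (overlap U V i j * a i * Real.log (b j / a i) +
          overlap U V i j * a i * Real.log t) =
          overlap U V i j * a i * (t * b j / a i - 1 - Real.log (t * b j / a i)) := by
        rw [hlog]; field_simp
      rw [heq]
      refine ⟨mul_nonneg hpos.le (by linarith [Real.log_le_sub_one_of_pos hx]), fun h => ?_⟩
      right
      by_contra hne
      have := Real.log_lt_sub_one_of_pos hx fun h1 => hne (by field_simp at h1; exact h1.symm)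
      have := mul_pos hpos (sub_pos.mpr this)
      linarith
  have hsum : ∑ i, ∑ j, (overlap U V i j * (t * b j - a i) -
        (overlap U V i j * a i * Real.log (b j / a i) + overlap U V i j * a i * Real.log t)) =
      -(spectralEntropy A + ∑ j, ((Vᴴ * A * V) j j).re * Real.log (b j)) -
        A.trace.re * Real.log t := by
    simp only [Finset.sum_sub_distrib, Finset.sum_add_distrib, mul_sub]
    rw [sum_overlap_mul_log hA hB ha hAB, Finset.sum_comm]
    simp only [← Finset.sum_mul, sum_overlap_right hA.left_inv hB.right_inv,
      sum_overlap_left hA.right_inv hB.left_inv, one_mul, ← Finset.mul_sum]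
    rw [← hA.trace_eq, ← hB.trace_eq, htr]
    ring
  refine ⟨?_, fun h => ?_⟩
  · have := Finset.sum_nonneg fun i (_ : i ∈ Finset.univ) =>
      Finset.sum_nonneg fun j (_ : j ∈ Finset.univ) => (hterm i j).1
    rw [hsum] at this
    linarith
  · rw [h, neg_neg, sub_self] at hsum
    have hz : ∀ i j, overlap U V i j = 0 ∨ a i = t * b j := by
      intro i j
      have h1 := (Finset.sum_eq_zero_iff_of_nonneg fun i _ =>
        Finset.sum_nonneg fun j _ => (hterm i j).1).mp hsum i (Finset.mem_univ i)
      exact (hterm i j).2 ((Finset.sum_eq_zero_iff_of_nonneg fun j _ =>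
        (hterm i j).1).mp h1 j (Finset.mem_univ j))
    -- The change of basis `Uᴴ * V` intertwines the two spectra, since its entry vanishes wherever
    -- a_i ≠ t b_j.
    have hW : diagonal (fun i => (a i : ℂ)) * (Uᴴ * V) =
        (t : ℂ) • ((Uᴴ * V) * diagonal (fun i => (b i : ℂ))) := by
      ext i j
      rw [diagonal_mul, Matrix.smul_apply, mul_diagonal, smul_eq_mul]
      rcases hz i j with h | h
      · rw [Complex.normSq_eq_zero.mp h]; simp
      · rw [h]; push_cast; ring
    have e1 : A = U * (diagonal (fun i => (a i : ℂ)) * (Uᴴ * V)) * Vᴴ := by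
      rw [mul_assoc, mul_assoc, mul_assoc, hB.right_inv, mul_one, ← mul_assoc, ← hA.eq]
    have e2 : B = U * ((Uᴴ * V) * diagonal (fun i => (b i : ℂ))) * Vᴴ := by
      rw [← mul_assoc, ← mul_assoc, hA.right_inv, one_mul, ← hB.eq]
    rw [e1, hW, mul_smul_comm, smul_mul_assoc, ← e2]

theorem klein (hA : A.PosSemidef) {V : Matrix n n ℂ} {b : n → ℝ}
    (hB : Diagonalizes B V b) (hb : ∀ i, 0 ≤ b i) (hAB : (B - A).PosSemidef) :
    spectralEntropy A + ∑ j, ((Vᴴ * A * V) j j).re * Real.log (b j) ≤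
        Real.negMulLog A.trace.re + A.trace.re * Real.log B.trace.re ∧
      (spectralEntropy A + ∑ j, ((Vᴴ * A * V) j j).re * Real.log (b j) =
        Real.negMulLog A.trace.re + A.trace.re * Real.log B.trace.re →
        (B.trace.re : ℂ) • A = (A.trace.re : ℂ) • B) := by
  rcases (trace_re_nonneg hA).eq_or_lt with h0 | h0
  · rw [eq_zero_of_trace_re hA h0.symm]
    simp [spectralEntropy_zero]
  · have h1 : A.trace.re ≤ B.trace.re := by
      have := trace_re_nonneg hAB
      rw [trace_sub, Complex.sub_re] at this
      linarith
    have h2 := h0.trans_le h1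
    obtain ⟨U, a, hU, ha⟩ := exists_diagonalizes hA
    have hk := klein_of_trace_pos hU hB ha hb hAB (div_pos h0 h2) (by field_simp)
    have he : -(A.trace.re * Real.log (A.trace.re / B.trace.re)) =
        Real.negMulLog A.trace.re + A.trace.re * Real.log B.trace.re := by
      rw [Real.log_div h0.ne' h2.ne', Real.negMulLog]; ring
    rw [he] at hk
    refine ⟨hk.1, fun h => ?_⟩
    rw [hk.2 h, smul_smul, Complex.ofReal_div, mul_div_cancel₀]
    · simp only [trace_smul, smul_eq_mul, ← Complex.ofReal_div,
        Complex.re_ofReal_mul]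
      rw [div_mul_cancel₀ _ h2.ne']
    · exact_mod_cast h2.ne'

/-- Pairwise proportionality of the members of a family of states. -/
def Proportional (M : ι → Matrix n n ℂ) : Prop :=
  ∀ k l, (M l).trace • M k = (M k).trace • M l

omit [DecidableEq n] in
theorem proportional_iff {M : ι → Matrix n n ℂ} (hM : ∀ k, (M k).PosSemidef) :
    Proportional M ↔ ∀ k, (∑ l, M l).trace • M k = (M k).trace • ∑ l, M l := by
  refine ⟨fun h k => ?_, fun h k l => ?_⟩
  · rw [trace_sum, Finset.sum_smul, Finset.smul_sum]
    exact Finset.sum_congr rfl fun l _ => h k l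
  · by_cases hT : (∑ l, M l).trace = 0
    · have : ∑ l, M l = 0 := (posSemidef_sum_univ hM).trace_eq_zero_iff.mp hT
      have hz : ∀ k, M k = 0 := fun k => by
        have h1 := hM k
        have h2 := posSemidef_sum_sub hM k
        rw [this, zero_sub] at h2
        have h3 := trace_re_nonneg h1
        have h4 := trace_re_nonneg h2
        rw [trace_neg, Complex.neg_re] at h4
        exact eq_zero_of_trace_re h1 (by linarith)
      simp [hz]
    · have hk := h k
      have hl := h l
      refine smul_right_injective _ hT ?_
      simp only
      rw [smul_comm, hk, smul_comm (∑ l, M l).trace, hl, smul_comm]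

/-- Nonnegativity of the Holevo quantity of an ensemble: apply `klein` to each member against the
sum. Equality in the total forces it in every term, hence proportionality to the sum. -/
theorem sum_spectralEntropy_le {M : ι → Matrix n n ℂ} (hM : ∀ k, (M k).PosSemidef) :
    ∑ k, spectralEntropy (M k) ≤ spectralEntropy (∑ k, M k) +
        ∑ k, Real.negMulLog (M k).trace.re - Real.negMulLog (∑ k, (M k).trace.re) ∧
      (∑ k, spectralEntropy (M k) = spectralEntropy (∑ k, M k) +
        ∑ k, Real.negMulLog (M k).trace.re - Real.negMulLog (∑ k, (M k).trace.re) ↔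
        Proportional M) := by
  have hN := posSemidef_sum_univ hM
  have htr : (∑ k, M k).trace.re = ∑ k, (M k).trace.re := by rw [trace_sum, Complex.re_sum]
  obtain ⟨V, b, hB, hb⟩ := exists_diagonalizes hN
  have hk := fun k => klein (hM k) hB hb (posSemidef_sum_sub hM k)
  have hl : ∑ k, (spectralEntropy (M k) + ∑ j, ((Vᴴ * M k * V) j j).re * Real.log (b j)) =
      ∑ k, spectralEntropy (M k) - spectralEntropy (∑ k, M k) := by
    rw [Finset.sum_add_distrib, sum_conj_diag_mul_log hB]; ring
  have hr : ∑ k, (Real.negMulLog (M k).trace.re +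
        (M k).trace.re * Real.log (∑ k, M k).trace.re) =
      ∑ k, Real.negMulLog (M k).trace.re - Real.negMulLog (∑ k, (M k).trace.re) := by
    rw [Finset.sum_add_distrib, ← Finset.sum_mul, htr, Real.negMulLog]; ring
  have hle := Finset.sum_le_sum fun k (_ : k ∈ Finset.univ) => (hk k).1
  rw [hl, hr] at hle
  refine ⟨by linarith, fun h => ?_, fun h => ?_⟩
  · rw [proportional_iff hM]
    intro k
    rw [trace_eq_re (hM k), trace_eq_re hN]
    refine (hk k).2 ?_
    have hs := hl.trans ((by linarith : _ = _).trans hr.symm)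
    exact (Finset.sum_eq_sum_iff_of_le fun k _ => (hk k).1).mp hs k (Finset.mem_univ k)
  · rcases (trace_re_nonneg hN).eq_or_lt with h0 | h0
    · have hz : ∀ k, M k = 0 := fun k => by
        refine eq_zero_of_trace_re (hM k) (le_antisymm ?_ (trace_re_nonneg (hM k)))
        have := trace_re_nonneg (posSemidef_sum_sub hM k)
        rw [trace_sub, Complex.sub_re] at this
        linarith
      simp [hz, spectralEntropy_zero]
    · rw [proportional_iff hM] at h
      have hMk : ∀ k, M k = (((M k).trace.re / (∑ l, M l).trace.re : ℝ) : ℂ) • ∑ l, M l := by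
        intro k
        have hne : (∑ l, M l).trace ≠ 0 := fun h => by rw [h] at h0; simp at h0
        rw [Complex.ofReal_div, ← trace_eq_re (hM k), ← trace_eq_re hN, div_eq_inv_mul, mul_smul,
          ← h k, smul_smul, inv_mul_cancel₀ hne, one_smul]
      have hE : ∀ k, spectralEntropy (M k) =
          (M k).trace.re / (∑ l, M l).trace.re * spectralEntropy (∑ l, M l) +
          (Real.negMulLog (M k).trace.re + (M k).trace.re * Real.log (∑ l, M l).trace.re) := by
        intro k
        conv_lhs => rw [hMk k, spectralEntropy_smul hN.isHermitian]
        congr 1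
        by_cases hz : (M k).trace.re = 0
        · simp [hz]
        · rw [Real.negMulLog, Real.log_div hz h0.ne', Real.negMulLog]
          field_simp
          ring
      simp only [hE]
      rw [Finset.sum_add_distrib, hr, ← Finset.sum_mul, ← Finset.sum_div, ← htr, div_self h0.ne']
      ring

end Families

end TwoParty

namespace TwoParty

open Matrix
open scoped ComplexOrder

/-! ### Embeddings as regular block matrices; a symmetric formula for the leakage -/

section Amplitudes

variable {X Y A B : Type*} [Fintype X] [DecidableEq X] [Fintype Y] [DecidableEq Y]
  [Fintype A] [DecidableEq A] [Fintype B] [DecidableEq B]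

/-- The unnormalised state of Alice's working register, given the outcomes `x`, `y`. -/
def aliceState (Ψ : X → Y → Matrix A B ℂ) (x : X) (y : Y) : Matrix A A ℂ := Ψ x y * (Ψ x y)ᴴ

/-- The probability of the outcomes `x`, `y`. -/
noncomputable def weight (Ψ : X → Y → Matrix A B ℂ) (x : X) (y : Y) : ℝ :=
  (aliceState Ψ x y).trace.re

/-- The amplitudes with the roles of the two players exchanged. -/
def exchange (Ψ : X → Y → Matrix A B ℂ) : Y → X → Matrix B A ℂ := fun y x => (Ψ x y)ᴴ

/-- All amplitudes, as one matrix. -/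
def full (Ψ : X → Y → Matrix A B ℂ) : Matrix (X × A) (Y × B) ℂ :=
  Matrix.of fun i j => Ψ i.1 j.1 i.2 j.2

/-- The entropy, in nats, of either player's part of the state. -/
noncomputable def jointEntropy (Ψ : X → Y → Matrix A B ℂ) : ℝ :=
  spectralEntropy (full Ψ * (full Ψ)ᴴ)

/-- Given `x`, the state of Alice's working register does not depend on `y`. -/
def Regular (Ψ : X → Y → Matrix A B ℂ) : Prop := ∀ x, Proportional (aliceState Ψ x)

/-- The leakage, in nats, of a state that is regular for both players. -/
noncomputable def leakNats (Ψ : X → Y → Matrix A B ℂ) : ℝ :=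
  jointEntropy Ψ - ∑ x, ∑ y, spectralEntropy (aliceState Ψ x y) +
    2 * ∑ x, ∑ y, Real.negMulLog (weight Ψ x y) -
    ∑ x, Real.negMulLog (∑ y, weight Ψ x y) - ∑ y, Real.negMulLog (∑ x, weight Ψ x y)

/-- The amplitudes of a vector of the four registers. -/
def amplitudes (ψ : (X × A) × (Y × B) → ℂ) : X → Y → Matrix A B ℂ :=
  fun x y => Matrix.of fun a b => ψ ((x, a), (y, b))

/-- The conjugate vector with the two players exchanged. -/
def dualVector (ψ : (X × A) × (Y × B) → ℂ) : (Y × B) × (X × A) → ℂ :=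
  fun p => star (ψ (p.2, p.1))

variable (Ψ : X → Y → Matrix A B ℂ) (ψ : (X × A) × (Y × B) → ℂ)

omit [Fintype X] [DecidableEq X] [Fintype Y] [DecidableEq Y] [Fintype A] [DecidableEq A]
  [Fintype B] [DecidableEq B] in
theorem amplitudes_dualVector : amplitudes (dualVector ψ) = exchange (amplitudes ψ) := rfl

omit [Fintype X] [DecidableEq X] [Fintype Y] [DecidableEq Y] [Fintype A] [DecidableEq A]
  [Fintype B] [DecidableEq B] in
theorem exchange_exchange : exchange (exchange Ψ) = Ψ := by
  ext x y : 2
  exact conjTranspose_conjTranspose _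

omit [Fintype X] [DecidableEq X] [Fintype Y] [DecidableEq Y] [DecidableEq A]
  [DecidableEq B] in
theorem aliceState_posSemidef (x : X) (y : Y) : (aliceState Ψ x y).PosSemidef :=
  posSemidef_self_mul_conjTranspose _

omit [Fintype X] [DecidableEq X] [Fintype Y] [DecidableEq Y] [DecidableEq A]
  [DecidableEq B] in
theorem weight_nonneg (x : X) (y : Y) : 0 ≤ weight Ψ x y :=
  trace_re_nonneg (aliceState_posSemidef Ψ x y)

omit [Fintype X] [DecidableEq X] [Fintype Y] [DecidableEq Y] [DecidableEq A]
  [DecidableEq B] in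
theorem weight_exchange (x : X) (y : Y) : weight (exchange Ψ) y x = weight Ψ x y := by
  rw [weight, aliceState, exchange, conjTranspose_conjTranspose, trace_mul_comm]
  rfl

omit [Fintype X] [DecidableEq X] [Fintype Y] [DecidableEq Y] in
theorem spectralEntropy_aliceState_exchange (x : X) (y : Y) :
    spectralEntropy (aliceState (exchange Ψ) y x) = spectralEntropy (aliceState Ψ x y) := by
  rw [aliceState, exchange, conjTranspose_conjTranspose, spectralEntropy_mul_comm]
  rfl

theorem jointEntropy_exchange : jointEntropy (exchange Ψ) = jointEntropy Ψ := by
  have : full (exchange Ψ) = (full Ψ)ᴴ := rfl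
  rw [jointEntropy, this, conjTranspose_conjTranspose, spectralEntropy_mul_comm, jointEntropy]

theorem leakNats_exchange : leakNats (exchange Ψ) = leakNats Ψ := by
  simp only [leakNats, jointEntropy_exchange, weight_exchange, spectralEntropy_aliceState_exchange]
  rw [Finset.sum_comm, Finset.sum_comm (f := fun y x => Real.negMulLog (weight Ψ x y))]
  ring

omit [Fintype X] [DecidableEq X] [Fintype Y] [DecidableEq Y] [DecidableEq A]
  [DecidableEq B] in
theorem weight_amplitudes (x : X) (y : Y) :
    weight (amplitudes ψ) x y = ∑ a, ∑ b, ‖ψ ((x, a), (y, b))‖ ^ 2 := by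
  simp only [weight, aliceState, trace, diag_apply, Matrix.mul_apply, conjTranspose_apply,
    Complex.re_sum]
  refine Finset.sum_congr rfl fun a _ => Finset.sum_congr rfl fun b _ => ?_
  rw [← Complex.normSq_eq_norm_sq]
  simp [amplitudes, Complex.normSq_apply]

section QuantumInfo

variable {ι κ : Type*} [Fintype ι] [DecidableEq ι] [Fintype κ] [DecidableEq κ]

/-- The transpose accompanies the swap because `dualVector` conjugates the amplitudes, so that
exchanging the players turns each block into its adjoint. -/
theorem quantumInfo_swap (ρ : Matrix (ι × κ) (ι × κ) ℂ) :
    quantumInfo (Matrix.of fun i j : κ × ι => ρ j.swap i.swap) = quantumInfo ρ := by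
  have h1 : traceSecond (Matrix.of fun i j : κ × ι => ρ j.swap i.swap) = (traceFirst ρ)ᵀ := rfl
  have h2 : traceFirst (Matrix.of fun i j : κ × ι => ρ j.swap i.swap) = (traceSecond ρ)ᵀ := rfl
  have h3 : (Matrix.of fun i j : κ × ι => ρ j.swap i.swap) =
      reindex (Equiv.prodComm ι κ) (Equiv.prodComm ι κ) ρᵀ := rfl
  simp only [quantumInfo, vonNeumannEntropy_eq, h1, h2, spectralEntropy_transpose]
  rw [h3, spectralEntropy_reindex, spectralEntropy_transpose]
  ring

end QuantumInfo

omit [DecidableEq B] in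
theorem infoAA_Y_eq : infoAA_Y ψ = infoX_BB (dualVector ψ) := by
  rw [infoAA_Y, infoX_BB, ← quantumInfo_swap]
  congr 1
  ext ⟨y, i⟩ ⟨y', j⟩
  simp only [Matrix.of_apply, measureReg, Prod.swap, stateAAB, stateABB, dualVector, star_star,
    eq_comm (a := y')]
  simp only [mul_comm]

omit [DecidableEq B] in
theorem infoXA_Y_eq : infoXA_Y ψ = infoX_YB (dualVector ψ) := by
  rw [infoXA_Y, infoX_YB, ← quantumInfo_swap]
  congr 1
  ext ⟨y, i⟩ ⟨y', j⟩
  simp only [Matrix.of_apply, measureReg, Prod.swap, stateAAB, stateABB, dualVector, star_star,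
    Prod.mk.injEq, eq_comm (a := y'), eq_comm (a := j.1), and_comm (a := y = y')]
  simp only [mul_comm]

theorem spectralEntropy_transpose_mul_conjTranspose {m n : Type*} [Fintype m] [DecidableEq m]
    [Fintype n] [DecidableEq n] (C : Matrix m n ℂ) :
    spectralEntropy (Cᵀ * Cᵀᴴ) = spectralEntropy (C * Cᴴ) := by
  rw [spectralEntropy_mul_comm, ← spectralEntropy_transpose, transpose_mul, transpose_transpose]
  rfl

omit [DecidableEq X] [Fintype Y] [DecidableEq Y] [DecidableEq A] [DecidableEq B] [Fintype X] in
theorem trace_aliceState (x : X) (y : Y) :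
    (aliceState Ψ x y).trace = (weight Ψ x y : ℂ) :=
  trace_eq_re (aliceState_posSemidef Ψ x y)

omit [DecidableEq X] [DecidableEq Y] [DecidableEq A] [DecidableEq B] [Fintype X] in
theorem sum_stateABB (x : X) :
    ∑ k : Y × B, stateABB ψ (x, k) (x, k) = ((∑ y, weight (amplitudes ψ) x y : ℝ) : ℂ) := by
  rw [Complex.ofReal_sum, Fintype.sum_prod_type]
  refine Finset.sum_congr rfl fun y _ => ?_
  rw [← trace_aliceState]
  simp only [stateABB, aliceState, trace, diag_apply, Matrix.mul_apply, conjTranspose_apply]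
  rw [Finset.sum_comm]
  rfl

/-- Given x, the remaining registers are in a pure state, so Bob's part has the same nonzero
spectrum as Alice's working register, whose state is the sum of `aliceState` over y. -/
theorem infoX_BB_eq : infoX_BB ψ = (∑ x, Real.negMulLog (∑ y, weight (amplitudes ψ) x y) +
      jointEntropy (amplitudes ψ) -
      ∑ x, spectralEntropy (∑ y, aliceState (amplitudes ψ) x y)) / Real.log 2 := by
  set ρ := measureReg (fun i : X × (Y × B) => i.1) (stateABB ψ) with hρ
  have h1 : traceSecond ρ =
      diagonal fun x => ((∑ y, weight (amplitudes ψ) x y : ℝ) : ℂ) := by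
    ext x x'
    by_cases h : x = x'
    · subst h
      rw [diagonal_apply_eq, ← sum_stateABB]
      simp [hρ, traceSecond, measureReg]
    · simp [hρ, traceSecond, measureReg, h]
  have h2 : traceFirst ρ = (full (amplitudes ψ))ᵀ * (full (amplitudes ψ))ᵀᴴ := by
    ext i j
    rw [Matrix.mul_apply, Fintype.sum_prod_type]
    simp only [hρ, traceFirst, measureReg, if_true, stateABB]
    rfl
  let R : X → Matrix A (Y × B) ℂ := fun x => Matrix.of fun a j => amplitudes ψ x j.1 a j.2
  have h3 : ρ = Matrix.of fun i j : X × (Y × B) =>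
      if i.1 = j.1 then ((R i.1)ᵀ * (R i.1)ᵀᴴ) i.2 j.2 else 0 := by
    ext ⟨x, i⟩ ⟨x', j⟩
    by_cases h : x = x'
    · subst h
      simp only [hρ, measureReg, if_true, Matrix.of_apply, Matrix.mul_apply, stateABB]
      rfl
    · simp [hρ, measureReg, h]
  have h4 : ∀ x, R x * (R x)ᴴ = ∑ y, aliceState (amplitudes ψ) x y := by
    intro x
    ext a a'
    rw [Matrix.sum_apply, Matrix.mul_apply, Fintype.sum_prod_type]
    rfl
  rw [infoX_BB, ← hρ, quantumInfo, vonNeumannEntropy_eq, vonNeumannEntropy_eq, vonNeumannEntropy_eq,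
    h1, h2, spectralEntropy_diagonal, spectralEntropy_transpose_mul_conjTranspose]
  conv_lhs => rw [h3, spectralEntropy_block fun x => (R x)ᵀ * (R x)ᵀᴴ]
  simp only [spectralEntropy_transpose_mul_conjTranspose, h4, jointEntropy]
  ring

omit [DecidableEq A] in
theorem infoX_YB_eq : infoX_YB ψ = (∑ x, Real.negMulLog (∑ y, weight (amplitudes ψ) x y) +
      ∑ y, spectralEntropy (∑ x, aliceState (exchange (amplitudes ψ)) y x) -
      ∑ y, ∑ x, spectralEntropy (aliceState (exchange (amplitudes ψ)) y x)) / Real.log 2 := by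
  set ρ := measureReg (fun i : X × (Y × B) => (i.1, i.2.1)) (stateABB ψ) with hρ
  have h1 : traceSecond ρ =
      diagonal fun x => ((∑ y, weight (amplitudes ψ) x y : ℝ) : ℂ) := by
    ext x x'
    by_cases h : x = x'
    · subst h
      rw [diagonal_apply_eq, ← sum_stateABB]
      simp [hρ, traceSecond, measureReg]
    · simp [hρ, traceSecond, measureReg, h]
  have hst : ∀ x y b b', stateABB ψ (x, (y, b)) (x, (y, b')) =
      (aliceState (exchange (amplitudes ψ)) y x)ᵀ b b' := by
    intro x y b b'
    rw [transpose_apply, aliceState, Matrix.mul_apply]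
    refine Finset.sum_congr rfl fun a _ => ?_
    simp [exchange, amplitudes, mul_comm]
  have h2 : traceFirst ρ = Matrix.of fun i j : Y × B =>
      if i.1 = j.1 then (∑ x, aliceState (exchange (amplitudes ψ)) i.1 x)ᵀ i.2 j.2 else 0 := by
    ext ⟨y, b⟩ ⟨y', b'⟩
    by_cases h : y = y'
    · subst h
      simp [hρ, traceFirst, measureReg, hst, Matrix.sum_apply]
    · simp [hρ, traceFirst, measureReg, h]
  have h3 : reindex (Equiv.prodAssoc X Y B).symm (Equiv.prodAssoc X Y B).symm ρ =
      Matrix.of fun i j : (X × Y) × B =>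
      if i.1 = j.1 then (aliceState (exchange (amplitudes ψ)) i.1.2 i.1.1)ᵀ i.2 j.2 else 0 := by
    ext ⟨⟨x, y⟩, b⟩ ⟨⟨x', y'⟩, b'⟩
    by_cases h : (x, y) = (x', y')
    · obtain ⟨rfl, rfl⟩ := Prod.mk.inj h
      simp [hρ, measureReg, hst]
    · simp [hρ, measureReg, h, - Prod.mk.injEq]
  rw [infoX_YB, ← hρ, quantumInfo, vonNeumannEntropy_eq, vonNeumannEntropy_eq, vonNeumannEntropy_eq,
    h1, h2, spectralEntropy_diagonal,
    spectralEntropy_block fun y => (∑ x, aliceState (exchange (amplitudes ψ)) y x)ᵀ]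
  conv_lhs => rw [← spectralEntropy_reindex (Equiv.prodAssoc X Y B).symm ρ, h3,
    spectralEntropy_block (fun p : X × Y => (aliceState (exchange (amplitudes ψ)) p.2 p.1)ᵀ)]
  simp only [spectralEntropy_transpose, Fintype.sum_prod_type]
  rw [Finset.sum_comm (f := fun y x => spectralEntropy (aliceState (exchange (amplitudes ψ)) y x))]
  ring

-- Sum the Holevo inequality over x; equality of the sums is equality for every x, which is
-- proportionality.
omit [DecidableEq X] [DecidableEq Y] [DecidableEq B] in
theorem regular_iff : Regular Ψ ↔ ∑ x, ∑ y, spectralEntropy (aliceState Ψ x y) =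
    ∑ x, spectralEntropy (∑ y, aliceState Ψ x y) + ∑ x, ∑ y, Real.negMulLog (weight Ψ x y) -
      ∑ x, Real.negMulLog (∑ y, weight Ψ x y) := by
  have h := fun x => sum_spectralEntropy_le fun y => aliceState_posSemidef Ψ x y
  simp only [weight]
  rw [← Finset.sum_add_distrib, ← Finset.sum_sub_distrib,
    Finset.sum_eq_sum_iff_of_le fun x _ => (h x).1]
  exact ⟨fun hr x _ => (h x).2.mpr (hr x), fun hs x => (h x).2.mp (hs x (Finset.mem_univ x))⟩

variable {ψ} {P : X × Y → ℝ}

omit [DecidableEq X] [DecidableEq Y] in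
theorem classicalInfo_eq (P : X × Y → ℝ) : classicalInfo P =
    (∑ x, Real.negMulLog (∑ y, P (x, y)) + ∑ y, Real.negMulLog (∑ x, P (x, y)) -
      ∑ x, ∑ y, Real.negMulLog (P (x, y))) / Real.log 2 := by
  simp only [classicalInfo, shannonEntropy, marginalX, marginalY, Fintype.sum_prod_type]
  ring

omit [DecidableEq A] in
theorem infoX_YB_eq_iff (hP : ∀ x y, weight (amplitudes ψ) x y = P (x, y)) :
    infoX_YB ψ = classicalInfo P ↔ Regular (exchange (amplitudes ψ)) := by
  rw [infoX_YB_eq, classicalInfo_eq, regular_iff, div_left_inj' (Real.log_pos one_lt_two).ne']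
  simp only [weight_exchange, hP]
  rw [Finset.sum_comm (f := fun x y => Real.negMulLog (P (x, y)))]
  constructor <;> intro h <;> linarith

omit [DecidableEq B] in
theorem infoXA_Y_eq_iff (hP : ∀ x y, weight (amplitudes ψ) x y = P (x, y)) :
    infoXA_Y ψ = classicalInfo P ↔ Regular (amplitudes ψ) := by
  rw [infoXA_Y_eq, infoX_YB_eq, classicalInfo_eq, regular_iff,
    div_left_inj' (Real.log_pos one_lt_two).ne']
  simp only [amplitudes_dualVector, exchange_exchange, weight_exchange, hP]
  constructor <;> intro h <;> linarith

theorem isEmbedding_iff : IsEmbedding P ψ ↔ (∀ x y, weight (amplitudes ψ) x y = P (x, y)) ∧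
    Regular (amplitudes ψ) ∧ Regular (exchange (amplitudes ψ)) := by
  constructor
  · intro h
    have hP : ∀ x y, weight (amplitudes ψ) x y = P (x, y) := fun x y => by
      rw [weight_amplitudes, h.outcome]
    exact ⟨hP, (infoXA_Y_eq_iff hP).mp h.alice_work, (infoX_YB_eq_iff hP).mp h.bob_work⟩
  · rintro ⟨hP, hA, hB⟩
    exact ⟨fun x y => by rw [← hP, weight_amplitudes], (infoX_YB_eq_iff hP).mpr hB,
      (infoXA_Y_eq_iff hP).mpr hA⟩

theorem infoX_BB_sub_eq (hP : ∀ x y, weight (amplitudes ψ) x y = P (x, y))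
    (hA : Regular (amplitudes ψ)) :
    infoX_BB ψ - classicalInfo P = leakNats (amplitudes ψ) / Real.log 2 := by
  rw [infoX_BB_eq, classicalInfo_eq, ← sub_div]
  congr 1
  rw [regular_iff] at hA
  simp only [leakNats, ← hP]
  linarith

theorem leakageOf_eq (h : IsEmbedding P ψ) :
    leakageOf P ψ = leakNats (amplitudes ψ) / Real.log 2 := by
  obtain ⟨hP, hA, hB⟩ := isEmbedding_iff.mp h
  have h2 : infoAA_Y ψ - classicalInfo P = leakNats (amplitudes ψ) / Real.log 2 := by
    have hc : classicalInfo P = classicalInfo (fun p : Y × X => P p.swap) := by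
      rw [classicalInfo_eq, classicalInfo_eq]
      rw [Finset.sum_comm (f := fun x y => Real.negMulLog (P (x, y)))]
      simp only [Prod.swap]
      ring
    -- Bob's leakage is Alice's for the exchanged state, and `leakNats` is invariant under the
    -- exchange, so the maximum is over two equal numbers.
    rw [infoAA_Y_eq, hc, infoX_BB_sub_eq (P := fun p : Y × X => P p.swap), amplitudes_dualVector,
      leakNats_exchange]
    · intro y x
      rw [amplitudes_dualVector, weight_exchange, hP]
      rfl
    · rwa [amplitudes_dualVector]
  rw [leakageOf, infoX_BB_sub_eq hP hA, h2, max_self]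

end Amplitudes

end TwoParty

namespace TwoParty

open Matrix
open scoped ComplexOrder

set_option linter.unusedSectionVars false

/-! ### Superadditivity of the leakage over cells of outcomes -/

section Cells

variable {X Y A B : Type*} [Fintype X] [DecidableEq X] [Fintype Y] [DecidableEq Y]
  [Fintype A] [DecidableEq A] [Fintype B] [DecidableEq B]
  {U Z : Type*} [Fintype U] [DecidableEq U] [Fintype Z] [DecidableEq Z]

/-- The part of the state in which the function `g` of Bob's outcome has the value `z`. -/
def colMask (g : Y → Z) (z : Z) (Ψ : X → Y → Matrix A B ℂ) : X → Y → Matrix A B ℂ :=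
  fun x y => if g y = z then Ψ x y else 0

/-- The part of the state in which the functions `f` and `g` of the outcomes have the values
`u` and `z`. -/
def cell (f : X → U) (g : Y → Z) (u : U) (z : Z) (Ψ : X → Y → Matrix A B ℂ) :
    X → Y → Matrix A B ℂ :=
  fun x y => if f x = u ∧ g y = z then Ψ x y else 0

variable (f : X → U) (g : Y → Z) (u : U) (z : Z) (Ψ : X → Y → Matrix A B ℂ)

theorem aliceState_colMask (x : X) (y : Y) :
    aliceState (colMask g z Ψ) x y = if g y = z then aliceState Ψ x y else 0 := by
  by_cases h : g y = z <;> simp [aliceState, colMask, h]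

theorem weight_colMask (x : X) (y : Y) :
    weight (colMask g z Ψ) x y = if g y = z then weight Ψ x y else 0 := by
  rw [weight, aliceState_colMask]
  split <;> simp [weight]

theorem aliceState_cell (x : X) (y : Y) :
    aliceState (cell f g u z Ψ) x y = if f x = u ∧ g y = z then aliceState Ψ x y else 0 := by
  by_cases h : f x = u ∧ g y = z <;> simp [aliceState, cell, h]

theorem weight_cell (x : X) (y : Y) :
    weight (cell f g u z Ψ) x y = if f x = u ∧ g y = z then weight Ψ x y else 0 := by
  rw [weight, aliceState_cell]
  split <;> simp [weight]

theorem exchange_cell : exchange (cell f g u z Ψ) = colMask f u (exchange (colMask g z Ψ)) := by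
  funext y x
  by_cases h : f x = u <;> by_cases h' : g y = z <;> simp [exchange, cell, colMask, h, h']

variable {Ψ}

/-- Deleting blocks preserves proportionality, because the zero state is proportional to every
state. -/
theorem regular_of_ite {p : X → Y → Prop} [∀ x y, Decidable (p x y)] (h : Regular Ψ)
    {Φ : X → Y → Matrix A B ℂ}
    (hΦ : ∀ x y, aliceState Φ x y = if p x y then aliceState Ψ x y else 0) : Regular Φ := by
  intro x k l
  rw [hΦ, hΦ]
  by_cases hk : p x k <;> by_cases hl : p x l <;> simp [hk, hl, h x k l]

theorem regular_cell (h : Regular Ψ) : Regular (cell f g u z Ψ) :=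
  regular_of_ite h (aliceState_cell f g u z Ψ)

theorem regular_exchange_colMask (h : Regular (exchange Ψ)) :
    Regular (exchange (colMask g z Ψ)) :=
  regular_of_ite (p := fun y _ => g y = z) h fun y x => by
    by_cases h' : g y = z <;> simp [aliceState, exchange, colMask, h']

theorem regular_exchange_cell (h : Regular (exchange Ψ)) :
    Regular (exchange (cell f g u z Ψ)) := by
  rw [exchange_cell]
  exact regular_of_ite (p := fun _ x => f x = u) (regular_exchange_colMask g z h)
    fun y x => aliceState_colMask f u _ y x

/-- No signalling: a measurement by Bob leaves Alice's reduced state unchanged. -/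
theorem sum_full_colMask :
    ∑ z, full (colMask g z Ψ) * (full (colMask g z Ψ))ᴴ = full Ψ * (full Ψ)ᴴ := by
  ext i j
  rw [Matrix.sum_apply]
  simp only [Matrix.mul_apply]
  rw [Finset.sum_comm]
  refine Finset.sum_congr rfl fun k _ => ?_
  rw [Finset.sum_eq_single (g k.1)]
  · simp [full, colMask]
  · intro z _ hz
    simp [full, colMask, hz.symm]
  · simp

/-- The unitary acting as `W x` on Alice's working register, controlled by her outcome `x`. -/
def controlled (W : X → Matrix A A ℂ) : Matrix (X × A) (X × A) ℂ :=
  Matrix.of fun i j => if i.1 = j.1 then W i.1 i.2 j.2 else 0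

theorem controlled_mul_apply {κ : Type*} [Fintype κ] (W : X → Matrix A A ℂ)
    (C : Matrix (X × A) κ ℂ) (x : X) (k : A) (l : κ) :
    ((controlled W)ᴴ * C) (x, k) l = ∑ a, star (W x a k) * C (x, a) l := by
  rw [Matrix.mul_apply, Fintype.sum_prod_type, Finset.sum_eq_single x]
  · simp [controlled]
  · intro x' _ hx
    simp [controlled, hx]
  · simp

theorem controlled_unitary {W : X → Matrix A A ℂ} (hW : ∀ x, (W x)ᴴ * W x = 1) :
    (controlled W)ᴴ * controlled W = 1 := by
  ext ⟨x, k⟩ ⟨x', k'⟩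
  rw [controlled_mul_apply]
  by_cases h : x = x'
  · subst h
    have := congrFun (congrFun (hW x) k) k'
    rw [Matrix.mul_apply] at this
    simp only [controlled, Matrix.of_apply, if_true]
    simp only [conjTranspose_apply] at this
    rw [this]
    simp [Matrix.one_apply]
  · simp [controlled, h]

theorem controlled_conj_diag (W : X → Matrix A A ℂ) (x : X) (k : A) :
    ((controlled W)ᴴ * (full Ψ * (full Ψ)ᴴ) * controlled W) (x, k) (x, k) =
      ((W x)ᴴ * (∑ y, aliceState Ψ x y) * W x) k k := by
  have h1 : ((controlled W)ᴴ * (full Ψ * (full Ψ)ᴴ) * controlled W) =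
      ((controlled W)ᴴ * full Ψ) * ((controlled W)ᴴ * full Ψ)ᴴ := by
    rw [conjTranspose_mul, conjTranspose_conjTranspose]; simp only [Matrix.mul_assoc]
  have h2 : (W x)ᴴ * (∑ y, aliceState Ψ x y) * W x =
      ∑ y, ((W x)ᴴ * Ψ x y) * ((W x)ᴴ * Ψ x y)ᴴ := by
    rw [Finset.mul_sum, Finset.sum_mul]
    refine Finset.sum_congr rfl fun y _ => ?_
    rw [conjTranspose_mul, conjTranspose_conjTranspose, aliceState]; simp only [Matrix.mul_assoc]
  rw [h1, h2, Matrix.sum_apply, Matrix.mul_apply, Fintype.sum_prod_type]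
  refine Finset.sum_congr rfl fun y _ => ?_
  rw [Matrix.mul_apply]
  refine Finset.sum_congr rfl fun b _ => ?_
  rw [conjTranspose_apply, conjTranspose_apply, controlled_mul_apply, Matrix.mul_apply]
  rfl

/-- The unnormalised distribution is a product `p z * τ k / t`, so the entropy of `τ` cancels from
the difference. -/
theorem sum_negMulLog_product {D : Z → A → ℝ} {p : Z → ℝ} {τ : A → ℝ} {t : ℝ}
    (hD : ∀ z k, t * D z k = p z * τ k) (hτ : ∑ k, τ k = t) (hp : ∑ z, p z = t)
    (hp0 : ∀ z, 0 ≤ p z) (hD0 : ∀ z k, 0 ≤ D z k) (hDs : ∀ z, ∑ k, D z k = p z) :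
    ∑ z, ∑ k, Real.negMulLog (D z k) - ∑ k, Real.negMulLog (∑ z, D z k) =
      ∑ z, Real.negMulLog (p z) - Real.negMulLog t := by
  by_cases ht : t = 0
  · have hpz : ∀ z, p z = 0 := fun z =>
      (Finset.sum_eq_zero_iff_of_nonneg fun z _ => hp0 z).mp (hp.trans ht) z (Finset.mem_univ z)
    have hDz : ∀ z k, D z k = 0 := fun z k =>
      (Finset.sum_eq_zero_iff_of_nonneg fun k _ => hD0 z k).mp ((hDs z).trans (hpz z)) k
        (Finset.mem_univ k)
    simp [hpz, hDz, ht]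
  · have hD' : ∀ z k, D z k = p z / t * τ k := fun z k => by
      field_simp
      linarith [hD z k]
    have hs : ∀ k, ∑ z, D z k = τ k := fun k => by
      simp only [hD']
      rw [← Finset.sum_mul, ← Finset.sum_div, hp, div_self ht, one_mul]
    have hη : ∀ z, t * Real.negMulLog (p z / t) = Real.negMulLog (p z) + p z * Real.log t := by
      intro z
      by_cases hz : p z = 0
      · simp [hz]
      · rw [Real.negMulLog, Real.log_div hz ht, Real.negMulLog]
        field_simp
        ring
    have hz : ∀ z, ∑ k, Real.negMulLog (D z k) = Real.negMulLog (p z) + p z * Real.log t +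
        p z / t * ∑ k, Real.negMulLog (τ k) := by
      intro z
      simp only [hD', Real.negMulLog_mul, Finset.sum_add_distrib, ← Finset.sum_mul,
        ← Finset.mul_sum, hτ, hη]
    simp only [hz, hs, Finset.sum_add_distrib, ← Finset.sum_mul, ← Finset.sum_div, hp, div_self ht]
    rw [Real.negMulLog.eq_def t]
    ring

/-- Measuring the function `g` of Bob's outcome increases the entropy at most by its entropy given
Alice's outcome. -/
theorem sum_jointEntropy_colMask_le (h : Regular Ψ) :
    ∑ z, jointEntropy (colMask g z Ψ) ≤ jointEntropy Ψ +
      ∑ x, ∑ z, Real.negMulLog (∑ y, weight (colMask g z Ψ) x y) -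
      ∑ x, Real.negMulLog (∑ y, weight Ψ x y) := by
  have hT : ∀ x, (∑ y, aliceState Ψ x y).PosSemidef := fun x =>
    posSemidef_sum_univ fun y => aliceState_posSemidef Ψ x y
  -- For each x, `W x` diagonalises Alice's state given x; measuring x together with this eigenbasis
  -- is the measurement used in the bound.
  choose W τ hW _ using fun x => exists_diagonalizes (hT x)
  have hV := controlled_unitary fun x => (hW x).left_inv
  have hM : ∀ z, (full (colMask g z Ψ) * (full (colMask g z Ψ))ᴴ).PosSemidef := fun z =>
    posSemidef_self_mul_conjTranspose _
  have key := sum_spectralEntropy_le_conj_diag hM hV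
  rw [sum_full_colMask] at key
  simp only [Fintype.sum_prod_type, controlled_conj_diag] at key
  have hblock : ∀ x z, ∑ y, aliceState (colMask g z Ψ) x y =
      ∑ y, if g y = z then aliceState Ψ x y else 0 := fun x z =>
    Finset.sum_congr rfl fun y _ => aliceState_colMask g z Ψ x y
  have htr : ∀ (Φ : X → Y → Matrix A B ℂ) x, (∑ y, aliceState Φ x y).trace.re =
      ∑ y, weight Φ x y := fun Φ x => by rw [trace_sum, Complex.re_sum]; rfl
  have hx : ∀ x, ∑ z, ∑ k, Real.negMulLog
        (((W x)ᴴ * (∑ y, aliceState (colMask g z Ψ) x y) * W x) k k).re -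
      ∑ k, Real.negMulLog (∑ z, (((W x)ᴴ * (∑ y, aliceState (colMask g z Ψ) x y) * W x) k k).re) =
      ∑ z, Real.negMulLog (∑ y, weight (colMask g z Ψ) x y) -
        Real.negMulLog (∑ y, weight Ψ x y) := by
    intro x
    have hpsd : ∀ z, (∑ y, aliceState (colMask g z Ψ) x y).PosSemidef := fun z =>
      posSemidef_sum_univ fun y => aliceState_posSemidef _ x y
    refine sum_negMulLog_product (τ := τ x) ?_ ?_ ?_ ?_ ?_ ?_
    · intro z k
      -- Regularity: given x, restricting to `g y = z` only rescales Alice's state.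
      have hp : ((∑ y, weight Ψ x y : ℝ) : ℂ) • ∑ y, aliceState (colMask g z Ψ) x y =
          ((∑ y, weight (colMask g z Ψ) x y : ℝ) : ℂ) • ∑ y, aliceState Ψ x y := by
        have h1 := (proportional_iff fun y => aliceState_posSemidef Ψ x y).mp (h x)
        rw [← htr, ← trace_eq_re (hT x), ← htr, ← trace_eq_re (hpsd z), trace_sum _
          (fun y => aliceState (colMask g z Ψ) x y), Finset.sum_smul, Finset.smul_sum]
        refine Finset.sum_congr rfl fun y _ => ?_
        rw [aliceState_colMask]
        split
        · exact h1 y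
        · simp
      have h2 := congrArg (fun N => (((W x)ᴴ * N * W x) k k).re) hp
      simp only [mul_smul_comm, smul_mul_assoc, Matrix.smul_apply, smul_eq_mul,
        Complex.re_ofReal_mul, (hW x).conj_eq, diagonal_apply_eq, Complex.ofReal_re] at h2
      exact h2
    · rw [← htr, (hW x).trace_eq]
    · rw [Finset.sum_comm]
      refine Finset.sum_congr rfl fun y _ => ?_
      simp [weight_colMask]
    · exact fun z => Finset.sum_nonneg fun y _ => weight_nonneg _ _ _
    · exact fun z k => re_diag_nonneg ((hpsd z).conjTranspose_mul_mul_same _) k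
    · intro z
      rw [← htr, ← Complex.re_sum]
      have : ((W x)ᴴ * (∑ y, aliceState (colMask g z Ψ) x y) * W x).trace =
          (∑ y, aliceState (colMask g z Ψ) x y).trace := by
        rw [trace_mul_comm, ← mul_assoc, (hW x).right_inv, one_mul]
      rw [← this]
      rfl
  have hs := Finset.sum_congr (rfl : (Finset.univ : Finset X) = Finset.univ) fun x _ => hx x
  rw [Finset.sum_sub_distrib, Finset.sum_sub_distrib, Finset.sum_comm] at hs
  unfold jointEntropy
  linarith

theorem sum_fibers (F : Y → ℝ) : ∑ z, ∑ y, (if g y = z then F y else 0) = ∑ y, F y := by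
  rw [Finset.sum_comm]
  simp

theorem sum_cells (F : X → Y → ℝ) :
    ∑ u, ∑ z, ∑ x, ∑ y, (if f x = u ∧ g y = z then F x y else 0) = ∑ x, ∑ y, F x y := by
  rw [← sum_fibers f]
  refine Finset.sum_congr rfl fun u _ => ?_
  rw [Finset.sum_comm]
  refine Finset.sum_congr rfl fun x _ => ?_
  by_cases h : f x = u
  · simpa [h] using sum_fibers g (F x)
  · simp [h]

/-- The leakage is at least the sum of the leakages of the parts of the state given by functions of
the two outcomes. -/
theorem sum_leakNats_cell_le (hA : Regular Ψ) (hB : Regular (exchange Ψ)) :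
    ∑ u, ∑ z, leakNats (cell f g u z Ψ) ≤ leakNats Ψ := by
  -- Split first by Bob's `g`, then split each part by Alice's `f`; Bob's regularity survives the
  -- first split.
  have h1 := sum_jointEntropy_colMask_le g hA
  have h2 := Finset.sum_le_sum fun z (_ : z ∈ Finset.univ) =>
    sum_jointEntropy_colMask_le f (regular_exchange_colMask g z hB)
  simp only [← exchange_cell, jointEntropy_exchange, weight_exchange, Finset.sum_sub_distrib,
    Finset.sum_add_distrib] at h2
  have e1 : ∑ u, ∑ z, ∑ x, ∑ y, spectralEntropy (aliceState (cell f g u z Ψ) x y) =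
      ∑ x, ∑ y, spectralEntropy (aliceState Ψ x y) := by
    rw [← sum_cells f g]
    simp only [aliceState_cell, apply_ite spectralEntropy, spectralEntropy_zero]
  have e2 : ∑ u, ∑ z, ∑ x, ∑ y, Real.negMulLog (weight (cell f g u z Ψ) x y) =
      ∑ x, ∑ y, Real.negMulLog (weight Ψ x y) := by
    rw [← sum_cells f g]
    simp only [weight_cell, apply_ite Real.negMulLog, Real.negMulLog_zero]
  -- The value `u` is determined by `x`, so splitting by `f` does not refine the joint distribution
  -- of x and z.
  have e3 : ∑ u, ∑ z, ∑ x, Real.negMulLog (∑ y, weight (cell f g u z Ψ) x y) =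
      ∑ x, ∑ z, Real.negMulLog (∑ y, weight (colMask g z Ψ) x y) := by
    have : ∀ u z x, Real.negMulLog (∑ y, weight (cell f g u z Ψ) x y) =
        if f x = u then Real.negMulLog (∑ y, weight (colMask g z Ψ) x y) else 0 := by
      intro u z x
      by_cases h : f x = u <;> simp [weight_cell, weight_colMask, h]
    rw [Finset.sum_comm]
    simp only [this]
    rw [Finset.sum_comm (f := fun x z => Real.negMulLog (∑ y, weight (colMask g z Ψ) x y))]
    exact Finset.sum_congr rfl fun z _ => sum_fibers f _
  have e4 : ∑ z, ∑ y, Real.negMulLog (∑ x, weight (colMask g z Ψ) x y) =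
      ∑ y, Real.negMulLog (∑ x, weight Ψ x y) := by
    rw [← sum_fibers g]
    refine Finset.sum_congr rfl fun z _ => Finset.sum_congr rfl fun y _ => ?_
    by_cases h : g y = z <;> simp [weight_colMask, h]
  have e5 : ∑ u, ∑ z, ∑ y, Real.negMulLog (∑ x, weight (cell f g u z Ψ) x y) =
      ∑ z, ∑ y, ∑ u, Real.negMulLog (∑ x, weight (cell f g u z Ψ) x y) := by
    rw [Finset.sum_comm]
    exact Finset.sum_congr rfl fun z _ => Finset.sum_comm
  have e6 : ∑ u, ∑ z, jointEntropy (cell f g u z Ψ) =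
      ∑ z, ∑ u, jointEntropy (cell f g u z Ψ) := Finset.sum_comm
  simp only [leakNats, Finset.sum_sub_distrib, Finset.sum_add_distrib, ← Finset.mul_sum]
  linarith

end Cells

end TwoParty

namespace TwoParty

open Matrix
open scoped ComplexOrder

set_option linter.unusedSectionVars false

/-! ### Restriction to supports, rescaling, and construction of embeddings -/

section Transport

variable {X Y A B : Type*} [Fintype X] [DecidableEq X] [Fintype Y] [DecidableEq Y]
  [Fintype A] [DecidableEq A] [Fintype B] [DecidableEq B]
  {S T : Type*} [Fintype S] [DecidableEq S] [Fintype T] [DecidableEq T]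

variable {Ψ : X → Y → Matrix A B ℂ} {i : S → X} {j : T → Y}

/-- The amplitudes vanish unless the outcomes lie in the ranges of `i` and `j`. -/
def SupportedOn (Ψ : X → Y → Matrix A B ℂ) (i : S → X) (j : T → Y) : Prop :=
  ∀ x y, Ψ x y ≠ 0 → x ∈ Set.range i ∧ y ∈ Set.range j

theorem aliceState_eq_zero {x : X} {y : Y} (h : Ψ x y = 0) : aliceState Ψ x y = 0 := by
  simp [aliceState, h]

theorem weight_eq_zero {x : X} {y : Y} (h : Ψ x y = 0) : weight Ψ x y = 0 := by
  simp [weight, aliceState_eq_zero h]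

theorem eq_zero_of_weight {x : X} {y : Y} (h : weight Ψ x y = 0) : Ψ x y = 0 :=
  self_mul_conjTranspose_eq_zero.mp (eq_zero_of_trace_re (aliceState_posSemidef Ψ x y) h)

theorem SupportedOn.left (h : SupportedOn Ψ i j) {x : X} (hx : x ∉ Set.range i) (y : Y) :
    Ψ x y = 0 := by
  by_contra h0
  exact hx (h x y h0).1

theorem SupportedOn.right (h : SupportedOn Ψ i j) (x : X) {y : Y} (hy : y ∉ Set.range j) :
    Ψ x y = 0 := by
  by_contra h0
  exact hy (h x y h0).2

theorem jointEntropy_comp_right (hj : Function.Injective j)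
    (h : ∀ x, ∀ y ∉ Set.range j, Ψ x y = 0) :
    jointEntropy (fun x t => Ψ x (j t)) = jointEntropy Ψ := by
  rw [jointEntropy, jointEntropy]
  congr 1
  ext k l
  rw [Matrix.mul_apply, Matrix.mul_apply]
  refine Fintype.sum_of_injective (Prod.map j id) (hj.prodMap Function.injective_id) _ _ ?_ ?_
  · rintro ⟨y, b⟩ hy
    have : y ∉ Set.range j := fun ⟨t, ht⟩ => hy ⟨(t, b), by simp [ht]⟩
    simp [full, h _ y this]
  · rintro ⟨t, b⟩
    rfl

/-- Dropping zero columns leaves the Gram matrix unchanged; rows are handled by exchanging the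
players. -/
theorem jointEntropy_comp (hi : Function.Injective i) (hj : Function.Injective j)
    (h : SupportedOn Ψ i j) : jointEntropy (fun s t => Ψ (i s) (j t)) = jointEntropy Ψ := by
  rw [← jointEntropy_comp_right hj fun x y hy => h.right x hy, ← jointEntropy_exchange,
    ← jointEntropy_exchange (fun x t => Ψ x (j t)),
    ← jointEntropy_comp_right (Ψ := exchange fun x t => Ψ x (j t)) hi]
  · rfl
  · intro t x hx
    simp [exchange, h.left hx]

theorem sum_comp {F : X → Y → ℝ} (hi : Function.Injective i) (hj : Function.Injective j)
    (h : ∀ x y, F x y ≠ 0 → x ∈ Set.range i ∧ y ∈ Set.range j) :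
    ∑ s, ∑ t, F (i s) (j t) = ∑ x, ∑ y, F x y := by
  refine Fintype.sum_of_injective i hi _ _ (fun x hx => Finset.sum_eq_zero fun y _ => ?_)
    fun s => Fintype.sum_of_injective j hj _ _ (fun y hy => ?_) fun t => rfl
  · by_contra h0
    exact hx (h x y h0).1
  · by_contra h0
    exact hy (h _ y h0).2

theorem sum_negMulLog_comp (hi : Function.Injective i) (hj : Function.Injective j)
    (h : SupportedOn Ψ i j) :
    ∑ s, Real.negMulLog (∑ t, weight Ψ (i s) (j t)) =
      ∑ x, Real.negMulLog (∑ y, weight Ψ x y) := by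
  refine Fintype.sum_of_injective i hi _ _ (fun x hx => ?_) fun s => ?_
  · simp [weight_eq_zero (h.left hx _)]
  · congr 1
    exact Fintype.sum_of_injective j hj _ _ (fun y hy => weight_eq_zero (h.right _ hy)) fun t => rfl

theorem leakNats_comp (hi : Function.Injective i) (hj : Function.Injective j)
    (h : SupportedOn Ψ i j) : leakNats (fun s t => Ψ (i s) (j t)) = leakNats Ψ := by
  have h' : SupportedOn (exchange Ψ) j i := fun y x h0 => (h x y fun h1 => h0 (by
    simp [exchange, h1])).symm
  have e1 : ∑ s, ∑ t, spectralEntropy (aliceState Ψ (i s) (j t)) =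
      ∑ x, ∑ y, spectralEntropy (aliceState Ψ x y) :=
    sum_comp (F := fun x y => spectralEntropy (aliceState Ψ x y)) hi hj fun x y h0 =>
      h x y fun h1 => h0 (by rw [aliceState_eq_zero h1, spectralEntropy_zero])
  have e2 : ∑ s, ∑ t, Real.negMulLog (weight Ψ (i s) (j t)) =
      ∑ x, ∑ y, Real.negMulLog (weight Ψ x y) :=
    sum_comp (F := fun x y => Real.negMulLog (weight Ψ x y)) hi hj fun x y h0 =>
      h x y fun h1 => h0 (by rw [weight_eq_zero h1, Real.negMulLog_zero])
  have e3 := sum_negMulLog_comp hi hj h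
  have e4 := sum_negMulLog_comp hj hi h'
  simp only [weight_exchange] at e4
  rw [leakNats, leakNats, jointEntropy_comp hi hj h, ← e1, ← e2, ← e3, ← e4]
  rfl

theorem regular_comp (h : Regular Ψ) : Regular (fun s t => Ψ (i s) (j t)) :=
  fun s k l => h (i s) (j k) (j l)

theorem regular_of_comp (hs : SupportedOn Ψ i j) (h : Regular (fun s t => Ψ (i s) (j t))) :
    Regular Ψ := by
  intro x k l
  by_cases hk : Ψ x k = 0
  · simp [aliceState_eq_zero hk]
  by_cases hl : Ψ x l = 0
  · simp [aliceState_eq_zero hl]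
  obtain ⟨⟨s, rfl⟩, ⟨k, rfl⟩⟩ := hs _ _ hk
  obtain ⟨-, ⟨l, rfl⟩⟩ := hs _ _ hl
  exact h s k l

theorem smul_mul_conjTranspose_smul {m n : Type*} [Fintype n] (r : ℝ) (M : Matrix m n ℂ) :
    ((r : ℂ) • M) * ((r : ℂ) • M)ᴴ = ((r ^ 2 : ℝ) : ℂ) • (M * Mᴴ) := by
  rw [conjTranspose_smul, Matrix.smul_mul, Matrix.mul_smul, smul_smul, Complex.star_def,
    Complex.conj_ofReal, ← Complex.ofReal_mul, sq]

theorem aliceState_smul (r : ℝ) (x : X) (y : Y) :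
    aliceState (fun x y => (r : ℂ) • Ψ x y) x y = ((r ^ 2 : ℝ) : ℂ) • aliceState Ψ x y :=
  smul_mul_conjTranspose_smul r _

theorem weight_smul (r : ℝ) (x : X) (y : Y) :
    weight (fun x y => (r : ℂ) • Ψ x y) x y = r ^ 2 * weight Ψ x y := by
  rw [weight, aliceState_smul, trace_smul, smul_eq_mul, Complex.re_ofReal_mul, weight]

theorem regular_smul (r : ℝ) (h : Regular Ψ) : Regular (fun x y => (r : ℂ) • Ψ x y) := by
  intro x k l
  rw [aliceState_smul, aliceState_smul, trace_smul, trace_smul]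
  have := congrArg (fun N => (((r ^ 2 : ℝ) : ℂ) * ((r ^ 2 : ℝ) : ℂ)) • N) (h x k l)
  simp only [smul_smul, smul_eq_mul] at this ⊢
  convert this using 2 <;> ring

theorem exchange_smul (r : ℝ) :
    exchange (fun x y => (r : ℂ) • Ψ x y) = fun y x => (r : ℂ) • exchange Ψ y x := by
  funext y x
  simp [exchange]

theorem trace_full : (full Ψ * (full Ψ)ᴴ).trace.re = ∑ x, ∑ y, weight Ψ x y := by
  simp only [weight, ← Complex.re_sum]
  congr 1
  simp only [trace, Fintype.sum_prod_type, diag_apply]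
  refine Finset.sum_congr rfl fun x _ => ?_
  rw [Finset.sum_comm]
  refine Finset.sum_congr rfl fun a _ => ?_
  rw [Matrix.mul_apply, Fintype.sum_prod_type]
  refine Finset.sum_congr rfl fun y _ => ?_
  rw [aliceState, Matrix.mul_apply]
  rfl

theorem jointEntropy_smul (r : ℝ) : jointEntropy (fun x y => (r : ℂ) • Ψ x y) =
    r ^ 2 * jointEntropy Ψ + Real.negMulLog (r ^ 2) * ∑ x, ∑ y, weight Ψ x y := by
  have h : full (fun x y => (r : ℂ) • Ψ x y) * (full fun x y => (r : ℂ) • Ψ x y)ᴴ =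
      ((r ^ 2 : ℝ) : ℂ) • (full Ψ * (full Ψ)ᴴ) :=
    smul_mul_conjTranspose_smul r (full Ψ)
  rw [jointEntropy, h, spectralEntropy_smul (posSemidef_self_mul_conjTranspose _).isHermitian,
    trace_full, jointEntropy]

/-- The terms with `negMulLog (r ^ 2)` have total coefficient 1 - 1 + 2 - 1 - 1 = 0. -/
theorem leakNats_smul (r : ℝ) :
    leakNats (fun x y => (r : ℂ) • Ψ x y) = r ^ 2 * leakNats Ψ := by
  have hE : ∀ x y, spectralEntropy (aliceState (fun x y => (r : ℂ) • Ψ x y) x y) =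
      r ^ 2 * spectralEntropy (aliceState Ψ x y) + Real.negMulLog (r ^ 2) * weight Ψ x y :=
    fun x y => by
      rw [aliceState_smul, spectralEntropy_smul (aliceState_posSemidef Ψ x y).isHermitian, weight]
  simp only [leakNats, jointEntropy_smul, hE, weight_smul, ← Finset.mul_sum, Real.negMulLog_mul,
    Finset.sum_add_distrib, ← Finset.sum_mul]
  rw [Finset.sum_comm (f := fun y x => weight Ψ x y)]
  ring

theorem leakNats_unit (Φ : Unit → Unit → Matrix A B ℂ) : leakNats Φ = 0 := by
  have h : jointEntropy Φ = spectralEntropy (aliceState Φ () ()) := by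
    rw [jointEntropy, ← spectralEntropy_reindex (Equiv.uniqueProd A Unit)]
    congr 1
    ext a a'
    simp only [reindex_apply, submatrix_apply, Matrix.mul_apply, Fintype.sum_prod_type, aliceState]
    simp [full]
  simp [leakNats, h]
  ring

/-- Splitting by both outcomes completely leaves single blocks, each of leakage zero. -/
theorem leakNats_nonneg (hA : Regular Ψ) (hB : Regular (exchange Ψ)) : 0 ≤ leakNats Ψ := by
  refine le_trans (le_of_eq ?_) (sum_leakNats_cell_le id id hA hB)
  refine (Finset.sum_eq_zero fun x _ => Finset.sum_eq_zero fun y _ => ?_).symm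
  rw [← leakNats_comp (i := fun _ : Unit => x) (j := fun _ : Unit => y)
    (Function.injective_of_subsingleton _) (Function.injective_of_subsingleton _), leakNats_unit]
  intro x' y' h
  simp only [cell, id, ne_eq, ite_eq_right_iff, not_forall] at h
  obtain ⟨⟨rfl, rfl⟩, -⟩ := h
  simp

theorem leakageSet_nonneg {P : X × Y → ℝ} {Δ : ℝ} (h : Δ ∈ leakageSet P) : 0 ≤ Δ := by
  obtain ⟨a, b, ψ, hψ, rfl⟩ := h
  obtain ⟨-, hA, hB⟩ := isEmbedding_iff.mp hψ
  rw [leakageOf_eq hψ]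
  exact div_nonneg (leakNats_nonneg hA hB) (Real.log_pos one_lt_two).le

theorem leakageSet_bddBelow (P : X × Y → ℝ) : BddBelow (leakageSet P) :=
  ⟨0, fun _ => leakageSet_nonneg⟩

theorem proportional_of_one {κ : Type*} (M : κ → Matrix (Fin 1) (Fin 1) ℂ) : Proportional M := by
  intro k l
  ext i j
  simp [trace, Subsingleton.elim i 0, Subsingleton.elim j 0, mul_comm]

theorem leakageSet_nonempty {P : X × Y → ℝ} (hP : P ∈ stdSimplex ℝ (X × Y)) :
    (leakageSet P).Nonempty := by
  -- With one-dimensional working registers all states are scalars, so regularity is automatic.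
  let ψ : (X × Fin 1) × (Y × Fin 1) → ℂ := fun p => (√(P (p.1.1, p.2.1)) : ℂ)
  refine ⟨_, 1, 1, ψ, isEmbedding_iff.mpr ⟨fun x y => ?_, fun x => proportional_of_one _,
    fun y => proportional_of_one _⟩, rfl⟩
  rw [weight_amplitudes]
  simp [ψ, Real.sq_sqrt (hP.1 (x, y))]

/-- Amplitudes supported on a copy of the support of `P`, with weights proportional to `P`, give an
embedding of `P`. -/
theorem exists_embedding {X' Y' : Type*} [Fintype X'] [DecidableEq X'] [Fintype Y']
    [DecidableEq Y'] {a b : ℕ} {Ψ : X → Y → Matrix (Fin a) (Fin b) ℂ} {P : X' × Y' → ℝ}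
    {i' : S → X'} {j' : T → Y'} (hi : Function.Injective i) (hj : Function.Injective j)
    (hi' : Function.Injective i') (hj' : Function.Injective j') (h : SupportedOn Ψ i j)
    (hP : ∀ x y, P (x, y) ≠ 0 → x ∈ Set.range i' ∧ y ∈ Set.range j')
    (hA : Regular Ψ) (hB : Regular (exchange Ψ)) {c : ℝ} (hc : 0 < c)
    (hw : ∀ s t, weight Ψ (i s) (j t) = c * P (i' s, j' t)) :
    leakNats Ψ / c / Real.log 2 ∈ leakageSet P := by
  -- The factor `√c⁻¹` multiplies weights by `c⁻¹`, turning `c * P` into `P`; `Ω` then extends the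
  -- blocks by zero to the alphabets of `P`.
  let Φ : S → T → Matrix (Fin a) (Fin b) ℂ := fun s t => ((√c⁻¹ : ℝ) : ℂ) • Ψ (i s) (j t)
  let Ω : X' → Y' → Matrix (Fin a) (Fin b) ℂ := fun x y =>
    Function.extend (Prod.map i' j') (fun p => Φ p.1 p.2) 0 (x, y)
  have hinj := hi'.prodMap hj'
  have hΩ : (fun s t => Ω (i' s) (j' t)) = Φ := by
    funext s t
    exact hinj.extend_apply (fun p => Φ p.1 p.2) 0 (s, t)
  have hsupp : SupportedOn Ω i' j' := by
    intro x y h0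
    by_contra hn
    refine h0 (Function.extend_apply' _ _ _ ?_)
    rintro ⟨⟨s, t⟩, hst⟩
    obtain ⟨rfl, rfl⟩ := Prod.mk.inj hst
    exact hn ⟨⟨s, rfl⟩, ⟨t, rfl⟩⟩
  have hsupp' : SupportedOn (exchange Ω) j' i' := fun y x h0 => (hsupp x y fun h1 => h0 (by
    simp [exchange, h1])).symm
  have hsq : √c⁻¹ ^ 2 = c⁻¹ := Real.sq_sqrt (inv_nonneg.mpr hc.le)
  have hΦA : Regular Φ := regular_smul _ (regular_comp hA)
  have hΦB : Regular (exchange Φ) := by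
    have := regular_smul (√c⁻¹) (regular_comp (i := j) (j := i) hB)
    rwa [show exchange Φ = _ from exchange_smul (Ψ := fun s t => Ψ (i s) (j t)) (√c⁻¹)]
  let ψ : (X' × Fin a) × (Y' × Fin b) → ℂ := fun p => Ω p.1.1 p.2.1 p.1.2 p.2.2
  have hψ : amplitudes ψ = Ω := rfl
  have hemb : IsEmbedding P ψ := by
    refine isEmbedding_iff.mpr ⟨fun x y => ?_, ?_, ?_⟩
    · rw [hψ]
      by_cases hxy : x ∈ Set.range i' ∧ y ∈ Set.range j'
      · obtain ⟨⟨s, rfl⟩, ⟨t, rfl⟩⟩ := hxy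
        have h1 : weight Ω (i' s) (j' t) = weight Φ s t := by rw [← hΩ]; rfl
        rw [h1, weight_smul (Ψ := fun s t => Ψ (i s) (j t)), hsq]
        change c⁻¹ * weight Ψ (i s) (j t) = _
        rw [hw, inv_mul_cancel_left₀ hc.ne']
      · rw [weight_eq_zero, by_contra fun h0 => hxy (hP x y h0)]
        by_contra h0
        exact hxy (hsupp x y h0)
    · exact regular_of_comp hsupp (by rw [hψ, hΩ]; exact hΦA)
    · refine regular_of_comp hsupp' ?_
      rw [hψ]
      change Regular (exchange fun s t => Ω (i' s) (j' t))
      rw [hΩ]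
      exact hΦB
  refine ⟨a, b, ψ, hemb, ?_⟩
  rw [leakageOf_eq hemb, hψ, ← leakNats_comp hi' hj' hsupp, hΩ,
    leakNats_smul (Ψ := fun s t => Ψ (i s) (j t)), hsq, leakNats_comp hi hj h]
  ring

end Transport

/-! ### Cells that are copies of the primitive -/

section Relabeling

variable {X Y X₀ X₁ Y₀ Y₁ : Type*}
  [Fintype X] [DecidableEq X] [Fintype Y] [DecidableEq Y]
  [Fintype X₀] [DecidableEq X₀] [Fintype X₁] [DecidableEq X₁]
  [Fintype Y₀] [DecidableEq Y₀] [Fintype Y₁] [DecidableEq Y₁]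

theorem marginalX_ne_zero {P : X × Y → ℝ} (hP : ∀ p, 0 ≤ P p) {x : X} {y : Y}
    (h : P (x, y) ≠ 0) : marginalX P x ≠ 0 := fun h0 =>
  h ((Finset.sum_eq_zero_iff_of_nonneg fun y _ => hP (x, y)).mp h0 y (Finset.mem_univ y))

theorem marginalY_ne_zero {P : X × Y → ℝ} (hP : ∀ p, 0 ≤ P p) {x : X} {y : Y}
    (h : P (x, y) ≠ 0) : marginalY P y ≠ 0 := fun h0 =>
  h ((Finset.sum_eq_zero_iff_of_nonneg fun x _ => hP (x, y)).mp h0 x (Finset.mem_univ x))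

/-- A cell whose conditional distribution is `P` up to relabeling contributes at least its
probability times the leakage of `P`. -/
theorem mul_leakage_le_leakNats_cell {P : X × Y → ℝ} (hP : ∀ p, 0 ≤ P p)
    {P' : (X₀ × X₁) × (Y₀ × Y₁) → ℝ} (hP' : ∀ p, 0 ≤ P' p) {a b : ℕ}
    {Ψ : X₀ × X₁ → Y₀ × Y₁ → Matrix (Fin a) (Fin b) ℂ} (hw : ∀ x y, weight Ψ x y = P' (x, y))
    (hA : Regular Ψ) (hB : Regular (exchange Ψ)) (u : X₁) (z : Y₁)
    (h : EqualUpToRelabeling (conditional P' u z) P) :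
    secondMarginal P' u z * leakage P ≤ leakNats (cell Prod.snd Prod.snd u z Ψ) / Real.log 2 := by
  classical
  have hm0 : 0 ≤ secondMarginal P' u z :=
    Finset.sum_nonneg fun _ _ => Finset.sum_nonneg fun _ _ => hP' _
  have hA' := regular_cell Prod.snd Prod.snd u z hA
  have hB' := regular_exchange_cell Prod.snd Prod.snd u z hB
  -- A cell of probability zero cannot be normalised, but its left side vanishes.
  rcases hm0.eq_or_lt with h0 | hm
  · rw [← h0, zero_mul]
    exact div_nonneg (leakNats_nonneg hA' hB') (Real.log_pos one_lt_two).le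
  obtain ⟨e, e', he⟩ := h
  have hQ : ∀ p, 0 ≤ conditional P' u z p := fun p => div_nonneg (hP' _) hm.le
  have hmem : leakNats (cell Prod.snd Prod.snd u z Ψ) / secondMarginal P' u z / Real.log 2 ∈
      leakageSet P := by
    refine exists_embedding (S := {x : X // marginalX P x ≠ 0}) (T := {y : Y // marginalY P y ≠ 0})
      (i := fun s => ((e.symm s).1, u)) (j := fun t => ((e'.symm t).1, z))
      (i' := Subtype.val) (j' := Subtype.val) ?_ ?_ Subtype.val_injective Subtype.val_injective
      ?_ ?_ hA' hB' hm ?_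
    · intro s t hst
      exact e.symm.injective (Subtype.ext (Prod.mk.inj hst).1)
    · intro s t hst
      exact e'.symm.injective (Subtype.ext (Prod.mk.inj hst).1)
    · rintro ⟨x, u'⟩ ⟨y, z'⟩ hne
      simp only [cell, ne_eq, ite_eq_right_iff, not_forall] at hne
      obtain ⟨⟨rfl, rfl⟩, hne⟩ := hne
      have hne' : conditional P' u' z' (x, y) ≠ 0 := fun h0 => by
        refine hne (eq_zero_of_weight ?_)
        rw [hw]
        exact (div_eq_zero_iff.mp h0).resolve_right hm.ne'
      exact ⟨⟨e ⟨x, marginalX_ne_zero hQ hne'⟩, by simp⟩,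
        ⟨e' ⟨y, marginalY_ne_zero hQ hne'⟩, by simp⟩⟩
    · intro x y hne
      exact ⟨⟨⟨x, marginalX_ne_zero hP hne⟩, rfl⟩, ⟨⟨y, marginalY_ne_zero hP hne⟩, rfl⟩⟩
    · intro s t
      have hst := he (e.symm s) (e'.symm t)
      rw [Equiv.apply_symm_apply, Equiv.apply_symm_apply] at hst
      rw [weight_cell, if_pos ⟨rfl, rfl⟩, hw, ← hst, conditional, mul_div_cancel₀ _ hm.ne']
  have hle : leakage P ≤ _ := csInf_le (leakageSet_bddBelow P) hmem
  refine (mul_le_mul_of_nonneg_left hle hm.le).trans_eq ?_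
  field_simp

theorem relabelingProb_mul_leakage_le {P : X × Y → ℝ} (hP : P ∈ stdSimplex ℝ (X × Y))
    {P' : (X₀ × X₁) × (Y₀ × Y₁) → ℝ} (hP' : P' ∈ stdSimplex ℝ ((X₀ × X₁) × (Y₀ × Y₁))) :
    relabelingProb P' P * leakage P ≤ leakage P' := by
  classical
  refine le_csInf (leakageSet_nonempty hP') ?_
  rintro _ ⟨a, b, ψ, hψ, rfl⟩
  obtain ⟨hw, hA, hB⟩ := isEmbedding_iff.mp hψ
  have hlog := Real.log_pos one_lt_two
  rw [leakageOf_eq hψ]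
  refine le_trans ?_
    (div_le_div_of_nonneg_right (sum_leakNats_cell_le Prod.snd Prod.snd hA hB) hlog.le)
  rw [relabelingProb, Finset.sum_mul, ← Fintype.sum_prod_type' (f := fun u z =>
    leakNats (cell Prod.snd Prod.snd u z (amplitudes ψ))), Finset.sum_div]
  refine (Finset.sum_le_sum fun p hp => mul_leakage_le_leakNats_cell hP.1 hP'.1 hw hA hB p.1 p.2
    (Finset.mem_filter.mp hp).2).trans ?_
  -- Cells that are not copies of `P` are discarded, their leakage being nonnegative.
  refine Finset.sum_le_sum_of_subset_of_nonneg (Finset.filter_subset _ _) fun p _ _ => ?_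
  exact div_nonneg (leakNats_nonneg (regular_cell _ _ _ _ hA) (regular_exchange_cell _ _ _ _ hB))
    hlog.le

end Relabeling

end TwoParty

theorem mainTheorem10
    {X Y X₀ X₁ Y₀ Y₁ : Type*}
    [Fintype X] [DecidableEq X] [Fintype Y] [DecidableEq Y]
    [Fintype X₀] [DecidableEq X₀] [Fintype X₁] [DecidableEq X₁]
    [Fintype Y₀] [DecidableEq Y₀] [Fintype Y₁] [DecidableEq Y₁]
    (P : X × Y → ℝ) (hP : P ∈ stdSimplex ℝ (X × Y))
    (P' : (X₀ × X₁) × (Y₀ × Y₁) → ℝ) (hP' : P' ∈ stdSimplex ℝ ((X₀ × X₁) × (Y₀ × Y₁)))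
    (δ : ℝ) (h : 1 - δ ≤ TwoParty.relabelingProb P' P) :
    IsGLB (TwoParty.leakageSet P) (TwoParty.leakage P) ∧
      IsGLB (TwoParty.leakageSet P') (TwoParty.leakage P') ∧
      (1 - δ) * TwoParty.leakage P ≤ TwoParty.leakage P' := by
  refine ⟨isGLB_csInf (TwoParty.leakageSet_nonempty hP) (TwoParty.leakageSet_bddBelow P),
    isGLB_csInf (TwoParty.leakageSet_nonempty hP') (TwoParty.leakageSet_bddBelow P'), ?_⟩
  -- Nonnegativity lets `1 - δ`, of either sign, be replaced by the larger `relabelingProb`.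
  have h0 : 0 ≤ TwoParty.leakage P := Real.sInf_nonneg fun _ => TwoParty.leakageSet_nonneg
  exact (mul_le_mul_of_nonneg_right h h0).trans (TwoParty.relabelingProb_mul_leakage_le hP hP')
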